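/- Let $(X_t)_{t\in\mathbb Z}$ be a strictly stationary max-stable time series with $\alpha$-Fréchet margins, $\alpha>0$, that is: for every $k\ge 1$ there are functions $a>0$ and $b$ on $\mathbb Z$ such that the pointwise maximum of $k$ independent copies of $X$ has the same law as $(a_tX_t+b_t)_{t\in\mathbb Z}$, and $\mathbb P(X_t\le x)=\exp(-x^{-\alpha})$ for $x>0$ (and $=0$ for $x\le 0$). Let $\theta_t=-\log\mathbb P(X_0\le 1,\,X_t\le 1)$ be its pairwise extremal coefficients and assume short range dependence, $\sum_{t=1}^\infty(2-\theta_t)<\infty$. Let $T=\{0,t_1,\dots,t_N\}$ be a finite set of non-negative integers containing $0$, write $\mathbf X_t=(X_{t+s})_{s\in T}$, $p(u)=\mathbb P(X_0>u)$, $$C_0=\{x\in(0,\infty)^T: x_0>1\},\qquad C_T=\{x\in(0,\infty)^T: x_s>1\ \text{for all } s\in T\},$$ $$\hat p_n=\frac1n\sum_{t=1}^n\mathbf 1\{u_n^{-1}\mathbf X_t\in C_0\},\qquad \hat P_n=\frac1n\sum_{t=1}^n\mathbf 1\{u_n^{-1}\mathbf X_t\in C_T\}.$$ Let $u_n\to\infty$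 be a real sequence with $n\,p(u_n)\to\infty$. Then the limits $$\chi_T=\lim_{u\to\infty}\frac{\mathbb P(X_s>u\ \text{for all } s\in T)}{\mathbb P(X_0>u)},\qquad \kappa_{t,T}=\lim_{u\to\infty}\frac{\mathbb P(u^{-1}\mathbf X_0\in C_T,\ u^{-1}\mathbf X_t\in C_T)}{\mathbb P(X_0>u)}\quad(t\ge 0)$$ exist, $\sum_{t\ge1}\kappa_{t,T}<\infty$, and with $$\sigma_0^2=1+2\sum_{t=1}^\infty(2-\theta_t),\qquad \sigma_T^2=\chi_T+2\sum_{t=1}^\infty\kappa_{t,T}$$ one has, as $n\to\infty$, $$\operatorname{Var}\Big(\sqrt{n\,p(u_n)}\,\frac{\hat p_n}{p(u_n)}\Big)\to\sigma_0^2,\qquad \operatorname{Var}\Big(\sqrt{n\,p(u_n)}\,\frac{\hat P_n}{p(u_n)}\Big)\to\sigma_T^2,$$ $$\sqrt{n\,p(u_n)}\Big(\frac{\hat p_n}{p(u_n)}-1\Big)\xrightarrow{d}\mathcal N(0,\sigma_0^2),$$ $$\sqrt{n\,p(u_n)}\Big(\frac{\hat P_n}{p(u_n)}-\frac{\mathbb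 P(u_n^{-1}\mathbf X_0\in C_T)}{p(u_n)}\Big)\xrightarrow{d}\mathcal N(0,\sigma_T^2).$$ If moreover $n\,p(u_n)^3\to 0$, then also $$\sqrt{n\,p(u_n)}\Big(\frac{\hat P_n}{p(u_n)}-\chi_T\Big)\xrightarrow{d}\mathcal N(0,\sigma_T^2).$$ Here $\mathcal N(0,0)$ denotes the point mass at $0$. -/

import Mathlib

open MeasureTheory ProbabilityTheory Filter Topology

noncomputable section

namespace MaxStableSeries

variable {Ω : Type*} [MeasurableSpace Ω]

/-- The law of the whole time series `(X_t)_{t ∈ ℤ}`, a measure on the sequence space `ℤ → ℝ`. -/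
def pathLaw (P : Measure Ω) (X : ℤ → Ω → ℝ) : Measure (ℤ → ℝ) :=
  P.map (fun ω t => X t ω)

/-- (Strict) stationarity: every time shift of the series has the same law as the series. -/
def IsStationary (P : Measure Ω) (X : ℤ → Ω → ℝ) : Prop :=
  ∀ h : ℤ, pathLaw P (fun t => X (t + h)) = pathLaw P X

/-- Max-stability: for every number `k + 1 ≥ 1` of copies there are deterministic norming functions
`a > 0` and `b` such that the pointwise maximum of `k + 1` independent copies of `X` has the same
law, as a process, as `(a_t X_t + b_t)_{t ∈ ℤ}`. -/
def IsMaxStable (P : Measure Ω) (X : ℤ → Ω → ℝ) : Prop :=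
  ∀ k : ℕ, ∃ a b : ℤ → ℝ, (∀ t, 0 < a t) ∧
    (Measure.pi (fun _ : Fin (k + 1) => pathLaw P X)).map
        (fun y t => Finset.univ.sup' Finset.univ_nonempty (fun i => y i t))
      = (pathLaw P X).map (fun x t => a t * x t + b t)

/-- All one-dimensional marginals are (unit-scale) `α`-Fréchet:
`P(X_t ≤ x) = exp(-x^{-α})` for `x > 0`, and `0` for `x ≤ 0`. -/
def HasFrechetMargins (P : Measure Ω) (α : ℝ) (X : ℤ → Ω → ℝ) : Prop :=
  ∀ (t : ℤ) (x : ℝ), P.real {ω | X t ω ≤ x} = if 0 < x then Real.exp (-(x ^ (-α))) else 0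

/-- The extremal coefficient of a finite index set `S`: the mass `-log P(X_t ≤ 1 for all t ∈ S)` of
the complement of `[0,1]^S` under the exponent measure. -/
def extremalCoeff (P : Measure Ω) (X : ℤ → Ω → ℝ) (S : Finset ℤ) : ℝ :=
  -Real.log (P.real {ω | ∀ t ∈ S, X t ω ≤ 1})

/-- The pairwise extremal coefficient `θ_h`, that of the index set `{0, h}`. -/
def pairCoeff (P : Measure Ω) (X : ℤ → Ω → ℝ) (h : ℤ) : ℝ :=
  extremalCoeff P X {0, h}

/-- The exceedance probability `p(u) = P(X_0 > u)`. -/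
def exceedProb (P : Measure Ω) (X : ℤ → Ω → ℝ) (u : ℝ) : ℝ :=
  P.real {ω | u < X 0 ω}

/-- The vector `(X_{t+s})_{s ∈ T}`. -/
def window (X : ℤ → Ω → ℝ) (T : Finset ℕ) (t : ℤ) (ω : Ω) : T → ℝ :=
  fun s => X (t + ((s : ℕ) : ℤ)) ω

/-- The set of vectors `x > 0` indexed by `T` with `x_s > 1` for all `s ∈ S`. For `S = {0}` this is
the set `C_0`, for `S = T` the set `C_T`. -/
def exceedSet (T S : Finset ℕ) : Set (T → ℝ) :=
  {x | (∀ s, 0 < x s) ∧ ∀ s : T, (s : ℕ) ∈ S → 1 < x s}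

/-- The event `u⁻¹ (X_{t+s})_{s ∈ T} ∈ C_S`. -/
def exceedEvent (X : ℤ → Ω → ℝ) (T S : Finset ℕ) (u : ℝ) (t : ℤ) : Set Ω :=
  {ω | u⁻¹ • window X T t ω ∈ exceedSet T S}

/-- The relative frequency `n⁻¹ ∑_{t=1}^n 1{u⁻¹ (X_{t+s})_{s ∈ T} ∈ C_S}`. -/
def relFreq (X : ℤ → Ω → ℝ) (T S : Finset ℕ) (u : ℝ) (n : ℕ) (ω : Ω) : ℝ :=
  (1 / (n : ℝ)) * ∑ t ∈ Finset.Icc 1 n, (exceedEvent X T S u (t : ℤ)).indicator (fun _ => (1 : ℝ)) ω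

/-- The denominator estimator: the relative frequency of exceedances at time `0` of the window. -/
def denomEst (X : ℤ → Ω → ℝ) (T : Finset ℕ) (u : ℝ) (n : ℕ) : Ω → ℝ :=
  relFreq X T {0} u n

/-- The numerator estimator: the relative frequency of joint exceedances at all times in `T`. -/
def numEst (X : ℤ → Ω → ℝ) (T : Finset ℕ) (u : ℝ) (n : ℕ) : Ω → ℝ :=
  relFreq X T T u n

/-- The ratio `P(X_t > u for all t ∈ T) / P(X_0 > u)`, whose limit is `χ_T`. -/
def chiRatio (P : Measure Ω) (X : ℤ → Ω → ℝ) (T : Finset ℕ) (u : ℝ) : ℝ :=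
  P.real {ω | ∀ s ∈ T, u < X ((s : ℕ) : ℤ) ω} / exceedProb P X u

/-- `χ_T = lim_{u → ∞} P(X_t > u for all t ∈ T) / P(X_0 > u)`. -/
def chi (P : Measure Ω) (X : ℤ → Ω → ℝ) (T : Finset ℕ) : ℝ :=
  limUnder atTop (chiRatio P X T)

/-- The ratio whose limit is `κ_{t,T}`. -/
def kappaRatio (P : Measure Ω) (X : ℤ → Ω → ℝ) (T : Finset ℕ) (t : ℕ) (u : ℝ) : ℝ :=
  P.real (exceedEvent X T T u 0 ∩ exceedEvent X T T u (t : ℤ)) / exceedProb P X u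

/-- `κ_{t,T}`, the limit as `u → ∞` of
`P(u⁻¹ (X_s)_{s ∈ T} ∈ C_T, u⁻¹ (X_{t+s})_{s ∈ T} ∈ C_T) / P(X_0 > u)`. -/
def kappa (P : Measure Ω) (X : ℤ → Ω → ℝ) (T : Finset ℕ) (t : ℕ) : ℝ :=
  limUnder atTop (kappaRatio P X T t)

/-- `σ_0² = 1 + 2 ∑_{t ≥ 1} (2 - θ_t)`. -/
def sigmaSqZero (P : Measure Ω) (X : ℤ → Ω → ℝ) : ℝ :=
  1 + 2 * ∑' t : ℕ, (2 - pairCoeff P X ((t : ℤ) + 1))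

/-- `σ_T² = χ_T + 2 ∑_{t ≥ 1} κ_{t,T}`. -/
def sigmaSq (P : Measure Ω) (X : ℤ → Ω → ℝ) (T : Finset ℕ) : ℝ :=
  chi P X T + 2 * ∑' t : ℕ, kappa P X T (t + 1)

/-- Convergence in distribution of real random variables on a common probability space to the
centred normal distribution `N(0, v)` (the point mass at `0` if `v = 0`). -/
def ConvergesToNormal (P : Measure Ω) [IsProbabilityMeasure P] (Z : ℕ → Ω → ℝ) (v : ℝ) : Prop :=
  0 ≤ v ∧ TendstoInDistribution Z atTop (id : ℝ → ℝ) (fun _ => P) (gaussianReal 0 v.toNNReal)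

end MaxStableSeries

end

/-!
Max-stability is used through positive association instead of mixing. With Fréchet margins the
norming functions are `a_t = k ^ (1 / α)` and `b_t = 0` (`norming_eq`), so the maximum of two
independent copies of `X` is a rescaling of `X`. For the random set of times in a finite set `J` at
which `X` exceeds `u`, the exceedance pattern, this says: the pattern over `u` is the union of two
independent patterns over the higher level `2 ^ (1 / α) * u` (`pattern_weights_union`). Iterating,
it is a union of `2 ^ m` independent patterns, each nonempty with probability `O(2 ^ (-m))`.
Monotone functions of one of them have covariance at least `-O(4 ^ (-m))`, and these errors add up
to `O(2 ^ (-m))` over the union; as `m → ∞`, monotone functions of the exceedance pattern are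
nonnegatively correlated (`integral_mul_pattern_ge`).

Association has two consequences. First, the covariance of two indicators of joint exceedances is
dominated by the sum of the covariances of the single exceedances involved, because the number of
exceedances minus the joint indicator is still monotone (`covariance_exceedInd_le_sum`). For single
exceedances at lag `h` the covariance is `exp(-θ_h x) - exp(-2 x) ≤ (2 - θ_h) x` with
`x = u ^ (-α)`. After division by `p(u)`, all lagged covariances are therefore dominated, uniformly
in the level, by a series that converges by short range dependence. Their limits exist by
inclusion-exclusion and the homogeneity `P(X_t ≤ u, t ∈ S) = exp(-θ_S u ^ (-α))`
(`cdf_diag_eq_exp`), with an error `O(p(u))` (`abs_prob_allExceed_div_sub_le`), and dominated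
convergence gives the limiting variances (`tendsto_variance_div`).

Second, the covariance of two monotone functions controls the error made when the characteristic
function of their sum is factorized (Newman's inequality, `IsAssociated.norm_chf_add_sub_le`).
The observations are cut into blocks of length `l → ∞` with `l ^ 4 ≤ n p(u_n)`. The sum of the
covariances between blocks is the variance of the whole sum minus that of the blocks; both have the
same limit, so the blocks may be treated as independent. Each block is small compared to
`√(n p(u_n))`, so its characteristic function is nearly Gaussian (`norm_chf_sub_exp_le`). This
yields the central limit theorem `tendsto_chf_normCount` for joint exceedances at translates of any
finite set of times, which is applied to `T` and to `{0}`.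
-/

namespace MaxStableSeries

variable {Ω : Type*} [MeasurableSpace Ω]

/-! ### Max-stability in normalized form -/

section Norming

variable {P : Measure Ω} {X : ℤ → Ω → ℝ} {α : ℝ}

lemma measurable_path (hX : ∀ t, Measurable (X t)) : Measurable (fun ω t => X t ω) :=
  measurable_pi_lambda _ hX

lemma pathLaw_real (hX : ∀ t, Measurable (X t)) {A : Set (ℤ → ℝ)} (hA : MeasurableSet A) :
    (pathLaw P X).real A = P.real {ω | (fun t => X t ω) ∈ A} :=
  map_measureReal_apply (measurable_path hX) hA

variable [IsProbabilityMeasure P]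

lemma isProbabilityMeasure_pathLaw (hX : ∀ t, Measurable (X t)) :
    IsProbabilityMeasure (pathLaw P X) :=
  Measure.isProbabilityMeasure_map (measurable_path hX).aemeasurable

lemma measurable_sup_copies (k : ℕ) : Measurable (fun (y : Fin (k + 1) → ℤ → ℝ) (t : ℤ) =>
    Finset.univ.sup' Finset.univ_nonempty (fun i => y i t)) := by
  refine measurable_pi_lambda _ fun t => ?_
  have := Finset.measurable_sup' (s := (Finset.univ : Finset (Fin (k + 1))))
    Finset.univ_nonempty (f := fun i (y : Fin (k + 1) → ℤ → ℝ) => y i t)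
    (fun i _ => by fun_prop)
  convert this using 1
  ext y
  simp

lemma measurableSet_forall_le (S : Finset ℤ) (x : ℤ → ℝ) :
    MeasurableSet {y : ℤ → ℝ | ∀ t ∈ S, y t ≤ x t} := by
  have : {y : ℤ → ℝ | ∀ t ∈ S, y t ≤ x t} = ⋂ t ∈ S, {y | y t ≤ x t} := by ext; simp
  rw [this]
  exact S.measurableSet_biInter fun t _ => measurableSet_le (by fun_prop) measurable_const

/-- Max-stability in terms of finite-dimensional distribution functions. -/
lemma cdf_pow_eq (hX : ∀ t, Measurable (X t)) {k : ℕ} {a b : ℤ → ℝ}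
    (ha : ∀ t, 0 < a t)
    (h : (Measure.pi (fun _ : Fin (k + 1) => pathLaw P X)).map
        (fun y t => Finset.univ.sup' Finset.univ_nonempty (fun i => y i t))
      = (pathLaw P X).map (fun x t => a t * x t + b t)) (S : Finset ℤ) (x : ℤ → ℝ) :
    P.real {ω | ∀ t ∈ S, X t ω ≤ x t} ^ (k + 1)
      = P.real {ω | ∀ t ∈ S, X t ω ≤ (x t - b t) / a t} := by
  have := isProbabilityMeasure_pathLaw (P := P) hX
  have hm := measurableSet_forall_le S x
  have e : ((Measure.pi (fun _ : Fin (k + 1) => pathLaw P X)).map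
        (fun y t => Finset.univ.sup' Finset.univ_nonempty (fun i => y i t))).real
          {y : ℤ → ℝ | ∀ t ∈ S, y t ≤ x t}
      = ((pathLaw P X).map (fun x t => a t * x t + b t)).real
          {y : ℤ → ℝ | ∀ t ∈ S, y t ≤ x t} := by rw [h]
  rw [map_measureReal_apply (measurable_sup_copies k) hm,
    map_measureReal_apply (by fun_prop) hm, pathLaw_real hX (hm.preimage (by fun_prop))] at e
  have e1 : ((fun (y : Fin (k + 1) → ℤ → ℝ) (t : ℤ) =>
      Finset.univ.sup' Finset.univ_nonempty (fun i => y i t)) ⁻¹'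
        {y : ℤ → ℝ | ∀ t ∈ S, y t ≤ x t})
      = Set.univ.pi (fun _ => {y : ℤ → ℝ | ∀ t ∈ S, y t ≤ x t}) := by
    ext y
    simp only [Set.mem_preimage, Set.mem_ofPred_eq, Finset.sup'_le_iff, Finset.mem_univ,
      forall_const, Set.mem_pi, Set.mem_univ]
    exact ⟨fun h i t ht => h t ht i, fun h t ht i => h i t ht⟩
  rw [e1, measureReal_def, Measure.pi_pi, ENNReal.toReal_prod] at e
  simp only [Finset.prod_const, Finset.card_univ, Fintype.card_fin] at e
  rw [← measureReal_def, pathLaw_real hX hm] at e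
  simp only [Set.mem_ofPred_eq, Set.mem_preimage] at e
  rw [e]
  congr 1
  ext ω
  simp only [Set.mem_ofPred_eq]
  refine forall₂_congr fun t _ => ?_
  rw [le_div_iff₀ (ha t)]
  constructor <;> intro h <;> linarith

/-- The Fréchet margins identify the norming functions: `b = 0` because the support of the law of
`X_t` starts at `0`, and `a_t ^ α = k + 1` by comparing values of the distribution function. -/
lemma norming_eq (hα : 0 < α) (hX : ∀ t, Measurable (X t)) (hfre : HasFrechetMargins P α X)
    {k : ℕ} {a b : ℤ → ℝ} (ha : ∀ t, 0 < a t)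
    (h : (Measure.pi (fun _ : Fin (k + 1) => pathLaw P X)).map
        (fun y t => Finset.univ.sup' Finset.univ_nonempty (fun i => y i t))
      = (pathLaw P X).map (fun x t => a t * x t + b t)) (t : ℤ) :
    b t = 0 ∧ a t = ((k : ℝ) + 1) ^ (1 / α) := by
  have key : ∀ x : ℝ, (if 0 < x then Real.exp (-(x ^ (-α))) else 0) ^ (k + 1)
      = if 0 < (x - b t) / a t then Real.exp (-(((x - b t) / a t) ^ (-α))) else 0 := by
    intro x
    have := cdf_pow_eq hX ha h {t} (fun _ => x)
    simpa [hfre t] using this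
  have hb : b t = 0 := by
    apply le_antisymm
    · by_contra hb
      have := key (b t)
      rw [if_pos (not_le.1 hb)] at this
      simp at this
    · by_contra hb
      have := key 0
      rw [if_pos (div_pos (by linarith) (ha t))] at this
      simp only [lt_self_iff_false, if_false, ne_eq, Nat.add_eq_zero_iff, one_ne_zero, and_false,
        not_false_eq_true, zero_pow] at this
      exact (Real.exp_pos _).ne this
  refine ⟨hb, ?_⟩
  have h1 := key 1
  have h2 : 0 < (1 - b t) / a t := by rw [hb]; simpa using ha t
  rw [if_pos one_pos, if_pos h2, hb, ← Real.exp_nat_mul] at h1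
  have h3 := Real.exp_injective h1
  simp only [Real.one_rpow, sub_zero, one_div] at h3
  rw [Real.inv_rpow (ha t).le, Real.rpow_neg (ha t).le, inv_inv] at h3
  push_cast at h3
  have h4 : a t ^ α = (k : ℝ) + 1 := by linarith
  rw [← h4, ← Real.rpow_mul (ha t).le, mul_one_div_cancel hα.ne', Real.rpow_one]

lemma map_sup_copies (hα : 0 < α) (hX : ∀ t, Measurable (X t)) (hmax : IsMaxStable P X)
    (hfre : HasFrechetMargins P α X) (k : ℕ) :
    (Measure.pi (fun _ : Fin (k + 1) => pathLaw P X)).map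
        (fun y t => Finset.univ.sup' Finset.univ_nonempty (fun i => y i t))
      = (pathLaw P X).map (fun x t => ((k : ℝ) + 1) ^ (1 / α) * x t) := by
  obtain ⟨a, b, ha, h⟩ := hmax k
  rw [h]
  congr 1
  ext x t
  obtain ⟨hb, ha'⟩ := norming_eq hα hX hfre ha h t
  rw [hb, ha', add_zero]

end Norming

/-! ### Finite-dimensional distribution functions on the diagonal -/

section Cdf

variable {P : Measure Ω} [IsProbabilityMeasure P] {X : ℤ → Ω → ℝ} {α : ℝ}

lemma cdf_diag_pow (hα : 0 < α) (hX : ∀ t, Measurable (X t)) (hmax : IsMaxStable P X)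
    (hfre : HasFrechetMargins P α X) (k : ℕ) (S : Finset ℤ) (x : ℝ) :
    P.real {ω | ∀ t ∈ S, X t ω ≤ x} ^ (k + 1)
      = P.real {ω | ∀ t ∈ S, X t ω ≤ x / ((k : ℝ) + 1) ^ (1 / α)} := by
  have h0 : (0 : ℝ) < (k : ℝ) + 1 := by positivity
  have := cdf_pow_eq (P := P) hX (k := k) (a := fun _ => ((k : ℝ) + 1) ^ (1 / α))
    (b := fun _ => 0) (fun _ => by positivity)
    (by simpa using map_sup_copies hα hX hmax hfre k) S (fun _ => x)
  simpa using this

lemma measurableSet_exceed (hX : ∀ t, Measurable (X t)) (t : ℤ) (u : ℝ) :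
    MeasurableSet {ω | u < X t ω} := measurableSet_lt measurable_const (hX t)

lemma prob_exceed (hX : ∀ t, Measurable (X t)) (hfre : HasFrechetMargins P α X)
    {u : ℝ} (hu : 0 < u) (t : ℤ) :
    P.real {ω | u < X t ω} = 1 - Real.exp (-(u ^ (-α))) := by
  have h := hfre t u
  rw [if_pos hu] at h
  rw [← h, ← probReal_compl_eq_one_sub (measurableSet_le (hX t) measurable_const)]
  congr 1
  ext ω
  simp

lemma exceedProb_eq (hX : ∀ t, Measurable (X t)) (hfre : HasFrechetMargins P α X)
    {u : ℝ} (hu : 0 < u) : exceedProb P X u = 1 - Real.exp (-(u ^ (-α))) :=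
  prob_exceed hX hfre hu 0

lemma prob_exceed_le (hX : ∀ t, Measurable (X t)) (hfre : HasFrechetMargins P α X)
    {u : ℝ} (hu : 0 < u) (t : ℤ) : P.real {ω | u < X t ω} ≤ u ^ (-α) := by
  rw [prob_exceed hX hfre hu]
  have := Real.add_one_le_exp (-(u ^ (-α)))
  linarith

lemma prob_exists_exceed_le (hX : ∀ t, Measurable (X t)) (hfre : HasFrechetMargins P α X)
    {u : ℝ} (hu : 0 < u) (S : Finset ℤ) :
    P.real {ω | ∃ t ∈ S, u < X t ω} ≤ S.card * u ^ (-α) := by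
  have : {ω | ∃ t ∈ S, u < X t ω} = ⋃ t ∈ S, {ω | u < X t ω} := by ext; simp
  rw [this]
  refine (measureReal_biUnion_finset_le S _).trans ?_
  refine (Finset.sum_le_sum fun t _ => prob_exceed_le hX hfre hu t).trans ?_
  simp

lemma measurableSet_forall_le' (hX : ∀ t, Measurable (X t)) (S : Finset ℤ) (x : ℝ) :
    MeasurableSet {ω | ∀ t ∈ S, X t ω ≤ x} :=
  (measurableSet_forall_le S (fun _ => x)).preimage (measurable_path hX)

/-- At a sufficiently high level `x * c` the distribution function is close to `1`, and its value
at `x` is a power of that. -/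
lemma cdf_diag_pos (hα : 0 < α) (hX : ∀ t, Measurable (X t)) (hmax : IsMaxStable P X)
    (hfre : HasFrechetMargins P α X) (S : Finset ℤ) {x : ℝ} (hx : 0 < x) :
    0 < P.real {ω | ∀ t ∈ S, X t ω ≤ x} := by
  obtain ⟨k, hk⟩ := exists_nat_gt (S.card * x ^ (-α))
  have hk0 : (0 : ℝ) < (k : ℝ) + 1 := by positivity
  set c : ℝ := ((k : ℝ) + 1) ^ (1 / α) with hc
  have hc0 : 0 < c := by positivity
  have h1 := cdf_diag_pow hα hX hmax hfre k S (x * c)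
  rw [mul_div_assoc, ← hc, div_self hc0.ne', mul_one] at h1
  rw [← h1]
  apply pow_pos
  have h2 := prob_exists_exceed_le hX hfre (mul_pos hx hc0) S
  have h3 : P.real {ω | ∃ t ∈ S, x * c < X t ω} = 1 - P.real {ω | ∀ t ∈ S, X t ω ≤ x * c} := by
    rw [← probReal_compl_eq_one_sub (measurableSet_forall_le' hX S _)]
    congr 1
    ext ω
    simp
  have h4 : (x * c) ^ (-α) = x ^ (-α) / ((k : ℝ) + 1) := by
    rw [Real.mul_rpow hx.le hc0.le, hc, ← Real.rpow_mul hk0.le]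
    rw [show 1 / α * -α = -1 by field_simp, Real.rpow_neg_one]
    rfl
  have h5 : S.card * (x * c) ^ (-α) < 1 := by
    rw [h4, ← mul_div_assoc, div_lt_one hk0]
    linarith
  linarith

/-- A monotone function on `(0, ∞)` that is homogeneous with respect to natural dilations is
linear. -/
lemma linear_of_monotone_of_nat_homogeneous {h : ℝ → ℝ}
    (hmono : ∀ x y, 0 < x → x ≤ y → h x ≤ h y)
    (hhom : ∀ (k : ℕ) (x : ℝ), 0 < x → h ((k + 1 : ℝ) * x) = (k + 1 : ℝ) * h x)
    {x : ℝ} (hx : 0 < x) : h x = h 1 * x := by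
  have h1 : 0 ≤ h 1 := by
    have := hmono 1 ((1 : ℕ) + 1 : ℝ) one_pos (by norm_num)
    have h2 := hhom 1 1 one_pos
    rw [mul_one] at h2
    rw [h2] at this
    push_cast at this
    linarith
  have hhom' : ∀ (n : ℕ) (x : ℝ), 0 < n → 0 < x → h ((n : ℝ) * x) = (n : ℝ) * h x := by
    intro n x hn hx
    obtain ⟨k, rfl⟩ := Nat.exists_eq_succ_of_ne_zero hn.ne'
    simpa using hhom k x hx
  -- `n h(x) = h(n x)` lies between the values of `h` at the integers next to `n x`
  have bound : ∀ᶠ n : ℕ in atTop, |h x - h 1 * x| ≤ h 1 / n := by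
    filter_upwards [eventually_gt_atTop ⌈1 / x⌉₊] with n hn
    have hn' : 1 / x < n := Nat.lt_of_ceil_lt hn
    have hn0 : (0 : ℝ) < n := lt_trans (by positivity) hn'
    have hnx : 1 < n * x := by rwa [div_lt_iff₀ hx] at hn'
    have hf0 : 0 < ⌊(n : ℝ) * x⌋₊ := Nat.floor_pos.2 hnx.le
    have hf1 : (⌊(n : ℝ) * x⌋₊ : ℝ) ≤ n * x := Nat.floor_le (by positivity)
    have hf2 : (n : ℝ) * x < ⌊(n : ℝ) * x⌋₊ + 1 := Nat.lt_floor_add_one _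
    have e := hhom' n x (by exact_mod_cast hn0) hx
    have e1 := hhom' ⌊(n : ℝ) * x⌋₊ 1 hf0 one_pos
    have e2 := hhom ⌊(n : ℝ) * x⌋₊ 1 one_pos
    rw [mul_one] at e1 e2
    have m1 := hmono _ _ (by exact_mod_cast hf0) hf1
    have m2 := hmono _ _ (by linarith) hf2.le
    rw [e, e1] at m1
    rw [e, e2] at m2
    rw [abs_le, le_div_iff₀ hn0, neg_le, le_div_iff₀ hn0]
    constructor <;> nlinarith
  have hlim : Tendsto (fun n : ℕ => h 1 / (n : ℝ)) atTop (𝓝 0) :=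
    tendsto_const_div_atTop_nhds_zero_nat _
  have h3 : |h x - h 1 * x| ≤ 0 := ge_of_tendsto hlim bound
  have := abs_nonpos_iff.1 h3
  linarith

/-- Homogeneity of the exponent measure: `P(X_t ≤ u for all t ∈ S) = exp(-θ_S u^{-α})`. -/
lemma cdf_diag_eq_exp (hα : 0 < α) (hX : ∀ t, Measurable (X t)) (hmax : IsMaxStable P X)
    (hfre : HasFrechetMargins P α X) (S : Finset ℤ) {u : ℝ} (hu : 0 < u) :
    P.real {ω | ∀ t ∈ S, X t ω ≤ u} = Real.exp (-(extremalCoeff P X S * u ^ (-α))) := by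
  set h : ℝ → ℝ := fun x => -Real.log (P.real {ω | ∀ t ∈ S, X t ω ≤ x ^ (-(1 / α))}) with hh
  have hpos : ∀ x : ℝ, 0 < x → 0 < P.real {ω | ∀ t ∈ S, X t ω ≤ x ^ (-(1 / α))} :=
    fun x hx => cdf_diag_pos hα hX hmax hfre S (by positivity)
  have key := linear_of_monotone_of_nat_homogeneous (h := h) ?_ ?_ (x := u ^ (-α)) (by positivity)
  · have e : (u ^ (-α)) ^ (-(1 / α)) = u := by
      rw [← Real.rpow_mul hu.le, show -α * -(1 / α) = 1 by field_simp, Real.rpow_one]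
    simp only [hh, e, Real.one_rpow] at key
    rw [extremalCoeff, ← key, neg_neg, Real.exp_log (cdf_diag_pos hα hX hmax hfre S hu)]
  · intro x y hx hxy
    simp only [hh]
    apply neg_le_neg
    apply Real.log_le_log (hpos y (hx.trans_le hxy))
    refine measureReal_mono fun ω hω t ht => (hω t ht).trans ?_
    exact Real.rpow_le_rpow_of_nonpos hx hxy (by simp [hα.le])
  · intro k x hx
    simp only [hh]
    have hk0 : (0 : ℝ) < (k : ℝ) + 1 := by positivity
    have e : (((k : ℝ) + 1) * x) ^ (-(1 / α)) = x ^ (-(1 / α)) / ((k : ℝ) + 1) ^ (1 / α) := by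
      rw [Real.mul_rpow hk0.le hx.le, Real.rpow_neg hk0.le,
        div_eq_mul_inv _ (((k : ℝ) + 1) ^ (1 / α)), mul_comm]
    rw [e, ← cdf_diag_pow hα hX hmax hfre, Real.log_pow]
    push_cast
    ring

end Cdf

/-! ### Association of exceedance patterns -/

/-- The expectation of a function of a random variable that takes finitely many values. -/
lemma integral_comp_of_finite_range {Ω β : Type*} [MeasurableSpace Ω] [DecidableEq β]
    (P : Measure Ω) [IsFiniteMeasure P] (Z : Ω → β) (s : Finset β) (hs : ∀ ω, Z ω ∈ s)
    (hZ : ∀ b ∈ s, MeasurableSet (Z ⁻¹' {b})) (φ : β → ℝ) :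
    ∫ ω, φ (Z ω) ∂P = ∑ b ∈ s, P.real (Z ⁻¹' {b}) * φ b := by
  have e : (fun ω => φ (Z ω))
      = fun ω => ∑ b ∈ s, (Z ⁻¹' {b}).indicator (fun _ => φ b) ω := by
    ext ω
    rw [Finset.sum_eq_single_of_mem (Z ω) (hs ω)]
    · simp
    · intro b _ hb
      exact Set.indicator_of_notMem (fun h => hb h.symm) _
  rw [e, integral_finsetSum]
  · refine Finset.sum_congr rfl fun b hb => ?_
    rw [integral_indicator_const _ (hZ b hb), smul_eq_mul]
  · intro b hb
    exact (integrable_const _).indicator (hZ b hb)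

/-- The exceedance pattern: the random set of times in `J` at which the path `x` exceeds `u`. -/
noncomputable def pattern (J : Finset ℤ) (u : ℝ) (x : ℤ → ℝ) : Finset ℤ :=
  J.filter (fun t => u < x t)

lemma mem_pattern {J : Finset ℤ} {u : ℝ} {x : ℤ → ℝ} {t : ℤ} :
    t ∈ pattern J u x ↔ t ∈ J ∧ u < x t := Finset.mem_filter

lemma pattern_mem_powerset (J : Finset ℤ) (u : ℝ) (x : ℤ → ℝ) : pattern J u x ∈ J.powerset :=
  Finset.mem_powerset.2 (Finset.filter_subset _ _)

lemma measurableSet_pattern (J : Finset ℤ) (u : ℝ) (A : Finset ℤ) :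
    MeasurableSet (pattern J u ⁻¹' {A}) := by
  have : pattern J u ⁻¹' {A} = {x : ℤ → ℝ | A ⊆ J} ∩ ⋂ t ∈ J, {x : ℤ → ℝ | u < x t ↔ t ∈ A} := by
    ext x
    simp only [Set.mem_preimage, Set.mem_singleton_iff, Set.mem_inter_iff, Set.mem_ofPred_eq,
      Set.mem_iInter, Finset.ext_iff, mem_pattern, Finset.subset_iff]
    constructor
    · intro h
      exact ⟨fun t ht => ((h t).2 ht).1, fun t ht => ⟨fun hu => (h t).1 ⟨ht, hu⟩,
        fun hA => ((h t).2 hA).2⟩⟩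
    · rintro ⟨h1, h2⟩ t
      exact ⟨fun h => (h2 t h.1).1 h.2, fun h => ⟨h1 h, (h2 t (h1 h)).2 h⟩⟩
  rw [this]
  refine MeasurableSet.inter (MeasurableSet.const _) (J.measurableSet_biInter fun t _ => ?_)
  by_cases h : t ∈ A
  · simpa [h] using measurableSet_lt measurable_const (measurable_pi_apply t)
  · simpa [h] using measurableSet_le (measurable_pi_apply t) measurable_const

section Weights

variable {κ : Type*}

/-- The bracket `∑ w φ ψ - (∑ w φ) (∑ w ψ)` of two functions of a random subset of `J` with
probability weights `w`, that is their covariance. -/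
def wcov (J : Finset κ) (w : Finset κ → ℝ) (φ ψ : Finset κ → ℝ) : ℝ :=
  ∑ A ∈ J.powerset, w A * (φ A * ψ A)
    - (∑ A ∈ J.powerset, w A * φ A) * ∑ A ∈ J.powerset, w A * ψ A

/-- Covariances do not change when constants are subtracted. -/
lemma wcov_sub_const {J : Finset κ} {w : Finset κ → ℝ} (hw1 : ∑ A ∈ J.powerset, w A = 1)
    (φ ψ : Finset κ → ℝ) (a b : ℝ) :
    wcov J w (fun A => φ A - a) (fun A => ψ A - b) = wcov J w φ ψ := by
  have e : ∑ A ∈ J.powerset, w A * ((φ A - a) * (ψ A - b))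
      = ∑ A ∈ J.powerset, w A * (φ A * ψ A) - (∑ A ∈ J.powerset, w A * φ A) * b
        - a * (∑ A ∈ J.powerset, w A * ψ A) + a * b * ∑ A ∈ J.powerset, w A := by
    rw [Finset.sum_mul, Finset.mul_sum, Finset.mul_sum, ← Finset.sum_sub_distrib,
      ← Finset.sum_sub_distrib, ← Finset.sum_add_distrib]
    exact Finset.sum_congr rfl fun A _ => by ring
  unfold wcov
  rw [e, hw1]
  simp only [mul_sub, Finset.sum_sub_distrib, ← Finset.sum_mul, hw1]
  ring

/-- If a random set is the union of two independent copies of another one, a lower bound for the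
covariances of monotone functions of the latter carries over with twice the error. -/
lemma wcov_union_ge [DecidableEq κ] {J : Finset κ} {w w' : Finset κ → ℝ} (hw0 : ∀ A, 0 ≤ w A)
    (hw1 : ∑ A ∈ J.powerset, w A = 1)
    (hww : ∀ φ : Finset κ → ℝ, ∑ A ∈ J.powerset, w' A * φ A
      = ∑ A ∈ J.powerset, ∑ B ∈ J.powerset, w A * w B * φ (A ∪ B))
    {M ε : ℝ}
    (h : ∀ φ ψ : Finset κ → ℝ, Monotone φ → Monotone ψ → (∀ A, 0 ≤ φ A ∧ φ A ≤ M) →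
      (∀ A, 0 ≤ ψ A ∧ ψ A ≤ M) → -ε ≤ wcov J w φ ψ)
    (φ ψ : Finset κ → ℝ) (hφ : Monotone φ) (hψ : Monotone ψ) (hφM : ∀ A, 0 ≤ φ A ∧ φ A ≤ M)
    (hψM : ∀ A, 0 ≤ ψ A ∧ ψ A ≤ M) : -(2 * ε) ≤ wcov J w' φ ψ := by
  -- the function obtained by averaging over the second copy
  set avg : (Finset κ → ℝ) → Finset κ → ℝ := fun f A => ∑ B ∈ J.powerset, w B * f (A ∪ B)
    with havg
  have avg_mono : ∀ f, Monotone f → Monotone (avg f) := fun f hf A A' hA =>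
    Finset.sum_le_sum fun B _ => mul_le_mul_of_nonneg_left
      (hf (Finset.union_subset_union_left hA)) (hw0 B)
  have avg_bd : ∀ f : Finset κ → ℝ, (∀ A, 0 ≤ f A ∧ f A ≤ M) → ∀ A, 0 ≤ avg f A ∧ avg f A ≤ M := by
    intro f hf A
    refine ⟨Finset.sum_nonneg fun B _ => mul_nonneg (hw0 B) (hf _).1, ?_⟩
    calc avg f A ≤ ∑ B ∈ J.powerset, w B * M :=
          Finset.sum_le_sum fun B _ => mul_le_mul_of_nonneg_left (hf _).2 (hw0 B)
      _ = M := by rw [← Finset.sum_mul, hw1, one_mul]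
  have e1 : ∀ f : Finset κ → ℝ, ∑ A ∈ J.powerset, w' A * f A
      = ∑ A ∈ J.powerset, w A * avg f A := by
    intro f
    rw [hww]
    refine Finset.sum_congr rfl fun A _ => ?_
    rw [havg, Finset.mul_sum]
    exact Finset.sum_congr rfl fun B _ => by ring
  have h2 := h (avg φ) (avg ψ) (avg_mono φ hφ) (avg_mono ψ hψ) (avg_bd φ hφM) (avg_bd ψ hψM)
  have h1 : ∀ A, -ε ≤ avg (fun C => φ C * ψ C) A - avg φ A * avg ψ A := fun A =>
    h (fun B => φ (A ∪ B)) (fun B => ψ (A ∪ B))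
      (fun B B' hB => hφ (Finset.union_subset_union_right hB))
      (fun B B' hB => hψ (Finset.union_subset_union_right hB)) (fun _ => hφM _) (fun _ => hψM _)
  have h3 : ∑ A ∈ J.powerset, w A * (-ε)
      ≤ ∑ A ∈ J.powerset, w A * (avg (fun C => φ C * ψ C) A - avg φ A * avg ψ A) :=
    Finset.sum_le_sum fun A _ => mul_le_mul_of_nonneg_left (h1 A) (hw0 A)
  rw [← Finset.sum_mul, hw1, one_mul] at h3
  simp only [mul_sub, Finset.sum_sub_distrib] at h3
  unfold wcov at h2 ⊢
  rw [e1 φ, e1 ψ, e1 (fun C => φ C * ψ C)]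
  linarith

/-- A crude lower bound for covariances when the random set is rarely nonempty. -/
lemma wcov_ge_of_rare [DecidableEq κ] {J : Finset κ} {w : Finset κ → ℝ} (hw0 : ∀ A, 0 ≤ w A)
    (hw1 : ∑ A ∈ J.powerset, w A = 1) {M q : ℝ} (hq : 1 - w ∅ ≤ q)
    (φ ψ : Finset κ → ℝ) (hφ : Monotone φ) (hψ : Monotone ψ) (hφM : ∀ A, 0 ≤ φ A ∧ φ A ≤ M)
    (hψM : ∀ A, 0 ≤ ψ A ∧ ψ A ≤ M) : -(M ^ 2 * q ^ 2) ≤ wcov J w φ ψ := by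
  have hM : 0 ≤ M := (hφM ∅).1.trans (hφM ∅).2
  have hbd : ∀ f : Finset κ → ℝ, Monotone f → (∀ A, 0 ≤ f A ∧ f A ≤ M) →
      0 ≤ ∑ A ∈ J.powerset, w A * (f A - f ∅) ∧
      ∑ A ∈ J.powerset, w A * (f A - f ∅) ≤ M * q := by
    intro f hf hfM
    refine ⟨Finset.sum_nonneg fun A _ => mul_nonneg (hw0 A)
      (sub_nonneg.2 (hf (Finset.empty_subset A))), ?_⟩
    have hmem : ∅ ∈ J.powerset := Finset.empty_mem_powerset J
    rw [← Finset.add_sum_erase _ _ hmem, sub_self, mul_zero, zero_add]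
    calc ∑ A ∈ J.powerset.erase ∅, w A * (f A - f ∅)
        ≤ ∑ A ∈ J.powerset.erase ∅, w A * M := Finset.sum_le_sum fun A _ =>
          mul_le_mul_of_nonneg_left (by linarith [(hfM A).2, (hfM ∅).1]) (hw0 A)
      _ = (1 - w ∅) * M := by
          rw [← Finset.sum_mul, ← hw1, ← Finset.add_sum_erase _ _ hmem]; ring
      _ ≤ M * q := by rw [mul_comm]; exact mul_le_mul_of_nonneg_left hq hM
  have hcov : wcov J w φ ψ = ∑ A ∈ J.powerset, w A * ((φ A - φ ∅) * (ψ A - ψ ∅))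
      - (∑ A ∈ J.powerset, w A * (φ A - φ ∅)) * ∑ A ∈ J.powerset, w A * (ψ A - ψ ∅) :=
    (wcov_sub_const hw1 φ ψ (φ ∅) (ψ ∅)).symm
  obtain ⟨p1, p2⟩ := hbd φ hφ hφM
  obtain ⟨q1, q2⟩ := hbd ψ hψ hψM
  have h0 : 0 ≤ ∑ A ∈ J.powerset, w A * ((φ A - φ ∅) * (ψ A - ψ ∅)) :=
    Finset.sum_nonneg fun A _ => mul_nonneg (hw0 A) (mul_nonneg
      (sub_nonneg.2 (hφ (Finset.empty_subset A))) (sub_nonneg.2 (hψ (Finset.empty_subset A))))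
  have h1 := mul_le_mul p2 q2 q1 (p1.trans p2)
  rw [hcov]
  nlinarith

end Weights

section Association

variable {P : Measure Ω} [IsProbabilityMeasure P] {X : ℤ → Ω → ℝ} {α : ℝ}

lemma integral_pattern (hX : ∀ t, Measurable (X t)) (J : Finset ℤ) (u : ℝ) (φ : Finset ℤ → ℝ) :
    ∫ ω, φ (pattern J u (fun t => X t ω)) ∂P
      = ∑ A ∈ J.powerset, (pathLaw P X).real (pattern J u ⁻¹' {A}) * φ A := by
  rw [integral_comp_of_finite_range P (fun ω => pattern J u (fun t => X t ω)) J.powerset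
    (fun ω => pattern_mem_powerset J u _)
    (fun A _ => (measurableSet_pattern J u A).preimage (measurable_path hX))]
  refine Finset.sum_congr rfl fun A _ => ?_
  rw [pathLaw_real hX (measurableSet_pattern J u A)]
  rfl

lemma sum_pattern_weights (hX : ∀ t, Measurable (X t)) (J : Finset ℤ) (u : ℝ) :
    ∑ A ∈ J.powerset, (pathLaw P X).real (pattern J u ⁻¹' {A}) = 1 := by
  have := integral_pattern (P := P) hX J u (fun _ => 1)
  simpa using this.symm

/-- The pattern of exceedances over `u` is the union of two independent copies of the pattern of
exceedances over the higher level `2 ^ (1 / α) * u`. -/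
lemma pattern_weights_union (hα : 0 < α) (hX : ∀ t, Measurable (X t)) (hmax : IsMaxStable P X)
    (hfre : HasFrechetMargins P α X) (J : Finset ℤ) (u : ℝ) (φ : Finset ℤ → ℝ) :
    ∑ A ∈ J.powerset, (pathLaw P X).real (pattern J u ⁻¹' {A}) * φ A
      = ∑ A ∈ J.powerset, ∑ B ∈ J.powerset,
        (pathLaw P X).real (pattern J ((2 : ℝ) ^ (1 / α) * u) ⁻¹' {A})
          * (pathLaw P X).real (pattern J ((2 : ℝ) ^ (1 / α) * u) ⁻¹' {B}) * φ (A ∪ B) := by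
  have := isProbabilityMeasure_pathLaw (P := P) hX
  set c : ℝ := (2 : ℝ) ^ (1 / α) with hc
  have hc0 : 0 < c := by positivity
  set v := c * u with hv
  set π := Measure.pi (fun _ : Fin (1 + 1) => pathLaw P X) with hπ
  have hmap := map_sup_copies hα hX hmax hfre 1
  rw [show ((1 : ℕ) : ℝ) + 1 = 2 by norm_num, ← hc] at hmap
  -- the law of the pattern over `v`, for the rescaled path and for the maximum of two copies
  have hw : ∀ A, (pathLaw P X).real (pattern J u ⁻¹' {A})
      = π.real ((fun y => pattern J v (y 0) ∪ pattern J v (y 1)) ⁻¹' {A}) := by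
    intro A
    have hm := measurableSet_pattern J v A
    have e := congrArg (fun m => m.real (pattern J v ⁻¹' {A})) hmap
    rw [map_measureReal_apply (measurable_sup_copies 1) hm,
      map_measureReal_apply (by fun_prop) hm] at e
    have e1 : (fun (x : ℤ → ℝ) t => c * x t) ⁻¹' (pattern J v ⁻¹' {A}) = pattern J u ⁻¹' {A} := by
      ext x
      simp only [Set.mem_preimage, Set.mem_singleton_iff]
      have : pattern J v (fun t => c * x t) = pattern J u x := by
        ext t
        simp only [mem_pattern, hv, mul_lt_mul_iff_right₀ hc0]
      rw [this]
    rw [e1] at e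
    rw [← e]
    congr 1
    ext y
    simp only [Set.mem_preimage, Set.mem_singleton_iff]
    have : pattern J v (fun t => Finset.univ.sup' Finset.univ_nonempty
        (fun i : Fin (1 + 1) => y i t)) = pattern J v (y 0) ∪ pattern J v (y 1) := by
      ext t
      simp only [mem_pattern, Finset.mem_union, Finset.lt_sup'_iff, Finset.mem_univ, true_and]
      have : (∃ i : Fin (1 + 1), v < y i t) ↔ v < y 0 t ∨ v < y 1 t := Fin.exists_fin_two
      rw [this]
      tauto
    rw [this]
  have hmeas : ∀ A B : Finset ℤ, (fun y : Fin (1 + 1) → ℤ → ℝ =>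
      (pattern J v (y 0), pattern J v (y 1))) ⁻¹' {(A, B)}
      = Set.univ.pi (![pattern J v ⁻¹' {A}, pattern J v ⁻¹' {B}] :
          Fin (1 + 1) → Set (ℤ → ℝ)) := by
    intro A B
    ext y
    simp [Set.mem_pi, Fin.forall_fin_two]
  have hmeas' : ∀ A B : Finset ℤ, MeasurableSet ((fun y : Fin (1 + 1) → ℤ → ℝ =>
      (pattern J v (y 0), pattern J v (y 1))) ⁻¹' {(A, B)}) := by
    intro A B
    rw [hmeas]
    refine MeasurableSet.univ_pi fun i => ?_
    fin_cases i
    · exact measurableSet_pattern J v A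
    · exact measurableSet_pattern J v B
  have hreal : ∀ A B : Finset ℤ, π.real ((fun y : Fin (1 + 1) → ℤ → ℝ =>
      (pattern J v (y 0), pattern J v (y 1))) ⁻¹' {(A, B)})
      = (pathLaw P X).real (pattern J v ⁻¹' {A}) * (pathLaw P X).real (pattern J v ⁻¹' {B}) := by
    intro A B
    rw [hmeas, measureReal_def, hπ, Measure.pi_pi, ENNReal.toReal_prod, Fin.prod_univ_two]
    rfl
  have hU : ∀ A ∈ J.powerset, MeasurableSet
      ((fun y : Fin (1 + 1) → ℤ → ℝ => pattern J v (y 0) ∪ pattern J v (y 1)) ⁻¹' {A}) := by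
    intro A _
    have : (fun y : Fin (1 + 1) → ℤ → ℝ => pattern J v (y 0) ∪ pattern J v (y 1)) ⁻¹' {A}
        = ⋃ b ∈ (J.powerset ×ˢ J.powerset).filter (fun b => b.1 ∪ b.2 = A),
          (fun y : Fin (1 + 1) → ℤ → ℝ => (pattern J v (y 0), pattern J v (y 1))) ⁻¹' {b} := by
      ext y
      simp only [Set.mem_preimage, Set.mem_singleton_iff, Finset.mem_filter, Finset.mem_product,
        Set.mem_iUnion, exists_prop]
      constructor
      · intro h
        exact ⟨_, ⟨⟨pattern_mem_powerset _ _ _, pattern_mem_powerset _ _ _⟩, h⟩, rfl⟩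
      · rintro ⟨b, ⟨_, h⟩, hb⟩
        rw [← hb] at h
        exact h
    rw [this]
    exact Finset.measurableSet_biUnion _ fun b _ => hmeas' b.1 b.2
  calc ∑ A ∈ J.powerset, (pathLaw P X).real (pattern J u ⁻¹' {A}) * φ A
      = ∫ y, φ (pattern J v (y 0) ∪ pattern J v (y 1)) ∂π := by
        rw [integral_comp_of_finite_range π
          (fun y => pattern J v (y 0) ∪ pattern J v (y 1)) J.powerset ?_ hU]
        · exact Finset.sum_congr rfl fun A _ => by rw [hw]
        · intro y
          exact Finset.mem_powerset.2 (Finset.union_subset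
            (Finset.mem_powerset.1 (pattern_mem_powerset _ _ _))
            (Finset.mem_powerset.1 (pattern_mem_powerset _ _ _)))
    _ = ∑ b ∈ J.powerset ×ˢ J.powerset, π.real ((fun y : Fin (1 + 1) → ℤ → ℝ =>
          (pattern J v (y 0), pattern J v (y 1))) ⁻¹' {b}) * φ (b.1 ∪ b.2) :=
        integral_comp_of_finite_range π
          (fun y : Fin (1 + 1) → ℤ → ℝ => (pattern J v (y 0), pattern J v (y 1)))
          (J.powerset ×ˢ J.powerset)
          (fun y => Finset.mem_product.2 ⟨pattern_mem_powerset _ _ _, pattern_mem_powerset _ _ _⟩)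
          (fun b _ => hmeas' b.1 b.2) (fun b => φ (b.1 ∪ b.2))
    _ = _ := by
        rw [Finset.sum_product]
        exact Finset.sum_congr rfl fun A _ => Finset.sum_congr rfl fun B _ => by rw [hreal]

lemma one_sub_pattern_empty_le (hX : ∀ t, Measurable (X t))
    (hfre : HasFrechetMargins P α X) (J : Finset ℤ) {u : ℝ} (hu : 0 < u) :
    1 - (pathLaw P X).real (pattern J u ⁻¹' {∅}) ≤ J.card * u ^ (-α) := by
  have := isProbabilityMeasure_pathLaw (P := P) hX
  rw [← probReal_compl_eq_one_sub (measurableSet_pattern J u ∅),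
    pathLaw_real hX (measurableSet_pattern J u ∅).compl]
  refine le_trans (le_of_eq ?_) (prob_exists_exceed_le hX hfre hu J)
  congr 1
  ext ω
  simp [pattern, Finset.filter_eq_empty_iff]

lemma wcov_pattern_ge (hα : 0 < α) (hX : ∀ t, Measurable (X t)) (hmax : IsMaxStable P X)
    (hfre : HasFrechetMargins P α X) (J : Finset ℤ) (M : ℝ) (m : ℕ) :
    ∀ {u : ℝ}, 0 < u → ∀ φ ψ : Finset ℤ → ℝ, Monotone φ → Monotone ψ →
      (∀ A, 0 ≤ φ A ∧ φ A ≤ M) → (∀ A, 0 ≤ ψ A ∧ ψ A ≤ M) →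
      -(M ^ 2 * (J.card * u ^ (-α)) ^ 2 * (1 / 2) ^ m)
        ≤ wcov J (fun A => (pathLaw P X).real (pattern J u ⁻¹' {A})) φ ψ := by
  induction m with
  | zero =>
    intro u hu φ ψ hφ hψ hφM hψM
    simpa using wcov_ge_of_rare (fun _ => measureReal_nonneg) (sum_pattern_weights hX J u)
      (one_sub_pattern_empty_le hX hfre J hu) φ ψ hφ hψ hφM hψM
  | succ m ih =>
    intro u hu φ ψ hφ hψ hφM hψM
    have hv : 0 < (2 : ℝ) ^ (1 / α) * u := by positivity
    have := wcov_union_ge (fun _ => measureReal_nonneg) (sum_pattern_weights hX J _)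
      (pattern_weights_union hα hX hmax hfre J u) (ih hv) φ ψ hφ hψ hφM hψM
    refine le_trans (le_of_eq ?_) this
    have e : ((2 : ℝ) ^ (1 / α) * u) ^ (-α) = u ^ (-α) / 2 := by
      rw [Real.mul_rpow (by positivity) hu.le, ← Real.rpow_mul (by norm_num),
        show 1 / α * -α = -1 by field_simp, Real.rpow_neg_one]
      ring
    rw [e]
    ring

/-- Association: monotone functions of the exceedance pattern are nonnegatively correlated. The
pattern over `u` is the union of `2 ^ m` independent patterns, each nonempty with probability
`O(2 ^ (-m))`, so the covariance is at least `-O(2 ^ m * 2 ^ (-2 * m))`. -/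
lemma integral_mul_pattern_ge (hα : 0 < α) (hX : ∀ t, Measurable (X t)) (hmax : IsMaxStable P X)
    (hfre : HasFrechetMargins P α X) (J : Finset ℤ) {u : ℝ} (hu : 0 < u) (φ ψ : Finset ℤ → ℝ)
    (hφ : Monotone φ) (hψ : Monotone ψ) :
    (∫ ω, φ (pattern J u (fun t => X t ω)) ∂P) * ∫ ω, ψ (pattern J u (fun t => X t ω)) ∂P
      ≤ ∫ ω, φ (pattern J u (fun t => X t ω)) * ψ (pattern J u (fun t => X t ω)) ∂P := by
  set w : Finset ℤ → ℝ := fun A => (pathLaw P X).real (pattern J u ⁻¹' {A}) with hw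
  have hw1 : ∑ A ∈ J.powerset, w A = 1 := sum_pattern_weights hX J u
  rw [integral_pattern hX, integral_pattern hX,
    integral_pattern hX J u (fun A => φ A * ψ A), ← sub_nonneg]
  change 0 ≤ wcov J w φ ψ
  -- truncation to subsets of `J` and centring at the empty set make the functions bounded
  set tr : (Finset ℤ → ℝ) → Finset ℤ → ℝ := fun f A => f (A ∩ J) - f ∅ with htr
  set M := max (φ J - φ ∅) (ψ J - ψ ∅) with hM
  have tr_mono : ∀ f, Monotone f → Monotone (tr f) := fun f hf A B hAB =>
    sub_le_sub_right (hf (Finset.inter_subset_inter_right hAB)) _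
  have tr_bd : ∀ f, Monotone f → f J - f ∅ ≤ M → ∀ A, 0 ≤ tr f A ∧ tr f A ≤ M := fun f hf hfM A =>
    ⟨sub_nonneg.2 (hf (Finset.empty_subset _)),
      (sub_le_sub_right (hf Finset.inter_subset_right) _).trans hfM⟩
  have e : wcov J w φ ψ = wcov J w (tr φ) (tr ψ) := by
    rw [← wcov_sub_const hw1 φ ψ (φ ∅) (ψ ∅)]
    have ht : ∀ f : Finset ℤ → ℝ, ∀ A ∈ J.powerset, tr f A = f A - f ∅ := fun f A hA => by
      simp only [htr, Finset.inter_eq_left.2 (Finset.mem_powerset.1 hA)]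
    unfold wcov
    congr 1
    · exact Finset.sum_congr rfl fun A hA => by rw [ht φ A hA, ht ψ A hA]
    · congr 1 <;> exact Finset.sum_congr rfl fun A hA => by rw [ht _ A hA]
  rw [e]
  have hlim : Tendsto (fun m : ℕ => -(M ^ 2 * (J.card * u ^ (-α)) ^ 2 * (1 / 2 : ℝ) ^ m))
      atTop (𝓝 0) := by
    have := (tendsto_pow_atTop_nhds_zero_of_lt_one (r := (1 / 2 : ℝ)) (by norm_num)
      (by norm_num)).const_mul (M ^ 2 * (J.card * u ^ (-α)) ^ 2)
    simpa using this.neg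
  exact le_of_tendsto' hlim fun m => wcov_pattern_ge hα hX hmax hfre J M m hu (tr φ) (tr ψ)
    (tr_mono φ hφ) (tr_mono ψ hψ) (tr_bd φ hφ (le_max_left _ _)) (tr_bd ψ hψ (le_max_right _ _))

end Association

/-! ### Joint exceedances -/

/-- The event that `X` exceeds `u` at all times in `S`. -/
def allExceed (X : ℤ → Ω → ℝ) (u : ℝ) (S : Finset ℤ) : Set Ω := {ω | ∀ j ∈ S, u < X j ω}

/-- The indicator variable of the event that `X` exceeds `u` at all times in `S`. -/
noncomputable def exceedInd (X : ℤ → Ω → ℝ) (u : ℝ) (S : Finset ℤ) : Ω → ℝ :=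
  (allExceed X u S).indicator (fun _ => 1)

/-- The monotone function of the exceedance pattern that detects `S`. -/
noncomputable def hits (S A : Finset ℤ) : ℝ := if S ⊆ A then 1 else 0

lemma hits_mono (S : Finset ℤ) : Monotone (hits S) := by
  intro A B hAB
  unfold hits
  split_ifs with h1 h2
  · exact le_rfl
  · exact absurd (h1.trans hAB) h2
  · exact zero_le_one
  · exact le_rfl

/-- The number of exceedances minus the indicator of a joint exceedance is still monotone. -/
lemma sum_hits_sub_hits_mono (S : Finset ℤ) :
    Monotone (fun A => ∑ i ∈ S, hits {i} A - hits S A) := by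
  intro A B hAB
  have hm : ∀ i ∈ S, 0 ≤ hits {i} B - hits {i} A := fun i _ =>
    sub_nonneg.2 (hits_mono {i} hAB)
  suffices h : hits S B - hits S A ≤ ∑ i ∈ S, (hits {i} B - hits {i} A) by
    rw [Finset.sum_sub_distrib] at h
    change _ - _ ≤ _ - _
    linarith
  by_cases hB : S ⊆ B
  · by_cases hA : S ⊆ A
    · simpa [hits, hA, hB] using Finset.sum_nonneg hm
    · obtain ⟨i, hiS, hiA⟩ := Finset.not_subset.1 hA
      refine le_trans (le_of_eq ?_) (Finset.single_le_sum hm hiS)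
      simp [hits, hA, hB, hiA, hB hiS]
  · have hA : ¬ S ⊆ A := fun h => hB (h.trans hAB)
    simpa [hits, hA, hB] using Finset.sum_nonneg hm

lemma exceedInd_nonneg {Ω : Type*} {X : ℤ → Ω → ℝ} (u : ℝ) (S : Finset ℤ) (ω : Ω) :
    0 ≤ exceedInd X u S ω :=
  Set.indicator_nonneg (fun _ _ => zero_le_one) _

lemma exceedInd_le_one {Ω : Type*} {X : ℤ → Ω → ℝ} (u : ℝ) (S : Finset ℤ) (ω : Ω) :
    exceedInd X u S ω ≤ 1 :=
  Set.indicator_le_self' (fun _ _ => zero_le_one) _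

lemma exceedInd_mul {Ω : Type*} {X : ℤ → Ω → ℝ} (u : ℝ) (S S' : Finset ℤ) :
    exceedInd X u S * exceedInd X u S' = exceedInd X u (S ∪ S') := by
  have : allExceed X u (S ∪ S') = allExceed X u S ∩ allExceed X u S' := by
    ext ω
    simp only [allExceed, Finset.mem_union, Set.mem_ofPred_eq, Set.mem_inter_iff]
    exact ⟨fun h => ⟨fun j hj => h j (Or.inl hj), fun j hj => h j (Or.inr hj)⟩,
      fun h j hj => hj.elim (h.1 j) (h.2 j)⟩
  ext ω
  simp only [exceedInd, this, Pi.mul_apply]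
  by_cases h1 : ω ∈ allExceed X u S <;> by_cases h2 : ω ∈ allExceed X u S' <;> simp [h1, h2]

lemma exceedInd_eq_hits {Ω : Type*} {X : ℤ → Ω → ℝ} {J S : Finset ℤ} (hS : S ⊆ J) (u : ℝ) (ω : Ω) :
    exceedInd X u S ω = hits S (pattern J u (fun t => X t ω)) := by
  have : ω ∈ allExceed X u S ↔ S ⊆ pattern J u (fun t => X t ω) :=
    ⟨fun h j hj => mem_pattern.2 ⟨hS hj, h j hj⟩, fun h j hj => (mem_pattern.1 (h hj)).2⟩
  by_cases h : ω ∈ allExceed X u S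
  · simp [exceedInd, hits, h, this.1 h]
  · simp [exceedInd, hits, h, mt this.2 h]

section Covariance

variable {P : Measure Ω} {X : ℤ → Ω → ℝ} {α : ℝ}

lemma measurable_comp_pattern (hX : ∀ t, Measurable (X t)) (J : Finset ℤ) (u : ℝ)
    (φ : Finset ℤ → ℝ) : Measurable (fun ω => φ (pattern J u (fun t => X t ω))) := by
  let _ : MeasurableSpace (Finset ℤ) := ⊤
  have h : Measurable (fun ω => pattern J u (fun t => X t ω)) :=
    measurable_to_countable' fun A =>
      (measurableSet_pattern J u A).preimage (measurable_path hX)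
  exact measurable_from_top.comp h

lemma measurableSet_allExceed (hX : ∀ t, Measurable (X t)) (u : ℝ) (S : Finset ℤ) :
    MeasurableSet (allExceed X u S) := by
  have : allExceed X u S = ⋂ j ∈ S, {ω | u < X j ω} := by ext; simp [allExceed]
  rw [this]
  exact S.measurableSet_biInter fun j _ => measurableSet_exceed hX j u

lemma measurable_exceedInd (hX : ∀ t, Measurable (X t)) (u : ℝ) (S : Finset ℤ) :
    Measurable (exceedInd X u S) :=
  measurable_const.indicator (measurableSet_allExceed hX u S)

lemma integral_exceedInd (hX : ∀ t, Measurable (X t)) (u : ℝ) (S : Finset ℤ) :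
    ∫ ω, exceedInd X u S ω ∂P = P.real (allExceed X u S) := by
  simp [exceedInd, integral_indicator_const _ (measurableSet_allExceed hX u S)]

/-! ### Stationarity -/

lemma prob_shift (hX : ∀ t, Measurable (X t)) (hstat : IsStationary P X) (h : ℤ)
    {B : Set (ℤ → ℝ)} (hB : MeasurableSet B) :
    P.real {ω | (fun t => X (t + h) ω) ∈ B} = P.real {ω | (fun t => X t ω) ∈ B} := by
  have e := congrArg (fun m => m.real B) (hstat h)
  simpa only [pathLaw_real (X := fun t => X (t + h)) (fun t => hX (t + h)) hB,
    pathLaw_real hX hB] using e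

/-- The translate of a finite set of times. -/
def shift (S : Finset ℤ) (h : ℤ) : Finset ℤ := S.image (fun t => t + h)

lemma forall_mem_shift {S : Finset ℤ} {h : ℤ} {p : ℤ → Prop} :
    (∀ j ∈ shift S h, p j) ↔ ∀ j ∈ S, p (j + h) := by
  simp only [shift, Finset.forall_mem_image]

lemma prob_allExceed_shift (hX : ∀ t, Measurable (X t)) (hstat : IsStationary P X) (u : ℝ)
    (S : Finset ℤ) (h : ℤ) :
    P.real (allExceed X u (shift S h)) = P.real (allExceed X u S) := by
  have hB : MeasurableSet {x : ℤ → ℝ | ∀ j ∈ S, u < x j} := by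
    have : {x : ℤ → ℝ | ∀ j ∈ S, u < x j} = ⋂ j ∈ S, {x | u < x j} := by ext; simp
    rw [this]
    exact S.measurableSet_biInter fun j _ => measurableSet_lt measurable_const (by fun_prop)
  have := prob_shift hX hstat h hB
  rw [← show allExceed X u (shift S h) = {ω | (fun t => X (t + h) ω) ∈ {x | ∀ j ∈ S, u < x j}} by
    ext ω; exact forall_mem_shift] at this
  exact this

lemma extremalCoeff_shift (hX : ∀ t, Measurable (X t)) (hstat : IsStationary P X)
    (S : Finset ℤ) (h : ℤ) : extremalCoeff P X (shift S h) = extremalCoeff P X S := by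
  have := prob_shift hX hstat h (measurableSet_forall_le S (fun _ => 1))
  unfold extremalCoeff
  rw [show {ω | ∀ t ∈ shift S h, X t ω ≤ 1}
    = {ω | (fun t => X (t + h) ω) ∈ {x : ℤ → ℝ | ∀ t ∈ S, x t ≤ 1}} by
      ext ω; exact forall_mem_shift, this]
  rfl

lemma extremalCoeff_pair (hX : ∀ t, Measurable (X t)) (hstat : IsStationary P X) (i j : ℤ) :
    extremalCoeff P X {i, j} = pairCoeff P X (j - i) := by
  rw [pairCoeff, ← extremalCoeff_shift hX hstat {0, j - i} i]
  congr 1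
  simp [shift, Finset.image_insert]

lemma pairCoeff_neg (hX : ∀ t, Measurable (X t)) (hstat : IsStationary P X) (h : ℤ) :
    pairCoeff P X (-h) = pairCoeff P X h := by
  have h1 := extremalCoeff_pair (P := P) hX hstat h 0
  have h2 := extremalCoeff_pair (P := P) hX hstat 0 h
  rw [Finset.pair_comm, h2] at h1
  simpa using h1.symm

lemma summable_two_sub_pairCoeff (hX : ∀ t, Measurable (X t)) (hstat : IsStationary P X)
    (hsrd : Summable (fun t : ℕ => 2 - pairCoeff P X ((t : ℤ) + 1))) :
    Summable (fun h : ℤ => 2 - pairCoeff P X h) := by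
  refine Summable.of_nat_of_neg_add_one ?_ ?_
  · rw [← summable_nat_add_iff 1]
    exact_mod_cast hsrd
  · refine hsrd.congr fun t => ?_
    rw [pairCoeff_neg hX hstat]

/-! ### Association bounds for joint exceedances -/

variable [IsProbabilityMeasure P]

lemma memLp_comp_pattern (hX : ∀ t, Measurable (X t)) (J : Finset ℤ) (u : ℝ)
    (φ : Finset ℤ → ℝ) : MemLp (fun ω => φ (pattern J u (fun t => X t ω))) 2 P := by
  refine MemLp.of_bound (measurable_comp_pattern hX J u φ).aestronglyMeasurable
    (∑ A ∈ J.powerset, ‖φ A‖) (ae_of_all _ fun ω => ?_)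
  exact Finset.single_le_sum (f := fun A => ‖φ A‖) (fun _ _ => norm_nonneg _)
    (pattern_mem_powerset J u _)

lemma covariance_pattern_nonneg (hα : 0 < α) (hX : ∀ t, Measurable (X t)) (hmax : IsMaxStable P X)
    (hfre : HasFrechetMargins P α X) (J : Finset ℤ) {u : ℝ} (hu : 0 < u) {φ ψ : Finset ℤ → ℝ}
    (hφ : Monotone φ) (hψ : Monotone ψ) :
    0 ≤ cov[fun ω => φ (pattern J u (fun t => X t ω)),
      fun ω => ψ (pattern J u (fun t => X t ω)); P] := by
  rw [covariance_eq_sub (memLp_comp_pattern hX J u φ) (memLp_comp_pattern hX J u ψ)]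
  exact sub_nonneg.2 (integral_mul_pattern_ge hα hX hmax hfre J hu φ ψ hφ hψ)

lemma memLp_exceedInd (hX : ∀ t, Measurable (X t)) (u : ℝ) (S : Finset ℤ) :
    MemLp (exceedInd X u S) 2 P := by
  refine MemLp.of_bound (measurable_exceedInd hX u S).aestronglyMeasurable 1
    (ae_of_all _ fun ω => ?_)
  rw [Real.norm_of_nonneg (exceedInd_nonneg u S ω)]
  exact exceedInd_le_one u S ω

lemma covariance_exceedInd (hX : ∀ t, Measurable (X t)) (u : ℝ) (S S' : Finset ℤ) :
    cov[exceedInd X u S, exceedInd X u S'; P]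
      = P.real (allExceed X u (S ∪ S')) - P.real (allExceed X u S) * P.real (allExceed X u S') := by
  rw [covariance_eq_sub (memLp_exceedInd hX u S) (memLp_exceedInd hX u S'), exceedInd_mul,
    integral_exceedInd hX, integral_exceedInd hX, integral_exceedInd hX]

lemma covariance_exceedInd_nonneg (hα : 0 < α) (hX : ∀ t, Measurable (X t))
    (hmax : IsMaxStable P X) (hfre : HasFrechetMargins P α X) {u : ℝ} (hu : 0 < u)
    (S S' : Finset ℤ) : 0 ≤ cov[exceedInd X u S, exceedInd X u S'; P] := by
  have h := covariance_pattern_nonneg hα hX hmax hfre (S ∪ S') hu (hits_mono S) (hits_mono S')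
  simp_rw [← exceedInd_eq_hits (X := X) (Finset.subset_union_left (s₁ := S) (s₂ := S')) u,
    ← exceedInd_eq_hits (X := X) (Finset.subset_union_right (s₁ := S) (s₂ := S')) u] at h
  exact h

/-- By association, covariances of joint exceedances are dominated by those of single ones. -/
lemma covariance_exceedInd_le_sum (hα : 0 < α) (hX : ∀ t, Measurable (X t))
    (hmax : IsMaxStable P X) (hfre : HasFrechetMargins P α X) {u : ℝ} (hu : 0 < u)
    (S S' : Finset ℤ) :
    cov[exceedInd X u S, exceedInd X u S'; P]
      ≤ ∑ i ∈ S, ∑ j ∈ S', cov[exceedInd X u {i}, exceedInd X u {j}; P] := by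
  have hsum : ∀ R : Finset ℤ, Monotone (fun A => ∑ i ∈ R, hits {i} A) := fun R A B hAB =>
    Finset.sum_le_sum fun i _ => hits_mono {i} hAB
  set pat : Ω → Finset ℤ := fun ω => pattern (S ∪ S') u (fun t => X t ω) with hpat
  have hmem : ∀ φ : Finset ℤ → ℝ, MemLp (fun ω => φ (pat ω)) 2 P :=
    memLp_comp_pattern hX (S ∪ S') u
  -- with counts `F`, `F'` and joint indicators `G`, `G'`:
  -- `cov(F, F') - cov(G, G') = cov(F - G, F') + cov(G, F' - G')`
  have h1 := covariance_pattern_nonneg hα hX hmax hfre (S ∪ S') hu (sum_hits_sub_hits_mono S)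
    (hsum S')
  have h2 := covariance_pattern_nonneg hα hX hmax hfre (S ∪ S') hu (hits_mono S)
    (sum_hits_sub_hits_mono S')
  change 0 ≤ cov[fun ω => ∑ i ∈ S, hits {i} (pat ω) - hits S (pat ω),
    fun ω => ∑ i ∈ S', hits {i} (pat ω); P] at h1
  change 0 ≤ cov[fun ω => hits S (pat ω),
    fun ω => ∑ i ∈ S', hits {i} (pat ω) - hits S' (pat ω); P] at h2
  rw [covariance_fun_sub_left (hmem fun A => ∑ i ∈ S, hits {i} A) (hmem _)
    (hmem fun A => ∑ i ∈ S', hits {i} A)] at h1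
  rw [covariance_fun_sub_right (hmem _) (hmem fun A => ∑ i ∈ S', hits {i} A) (hmem _)] at h2
  rw [covariance_fun_sum_fun_sum' (fun i _ => hmem _) (fun i _ => hmem _)] at h1
  have eS : (fun ω => hits S (pat ω)) = exceedInd X u S :=
    funext fun ω => (exceedInd_eq_hits Finset.subset_union_left u ω).symm
  have eS' : (fun ω => hits S' (pat ω)) = exceedInd X u S' :=
    funext fun ω => (exceedInd_eq_hits Finset.subset_union_right u ω).symm
  have ei : ∀ i ∈ S, (fun ω => hits {i} (pat ω)) = exceedInd X u {i} := fun i hi =>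
    funext fun ω => (exceedInd_eq_hits
      (Finset.singleton_subset_iff.2 (Finset.mem_union_left _ hi)) u ω).symm
  have ej : ∀ j ∈ S', (fun ω => hits {j} (pat ω)) = exceedInd X u {j} := fun j hj =>
    funext fun ω => (exceedInd_eq_hits
      (Finset.singleton_subset_iff.2 (Finset.mem_union_right _ hj)) u ω).symm
  rw [eS] at h1 h2
  rw [eS'] at h2
  have e3 : ∑ i ∈ S, ∑ j ∈ S', cov[fun ω => hits {i} (pat ω), fun ω => hits {j} (pat ω); P]
      = ∑ i ∈ S, ∑ j ∈ S', cov[exceedInd X u {i}, exceedInd X u {j}; P] :=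
    Finset.sum_congr rfl fun i hi => Finset.sum_congr rfl fun j hj => by rw [ei i hi, ej j hj]
  rw [e3] at h1
  linarith

/-! ### Limiting covariances of joint exceedances -/

lemma covariance_single (hα : 0 < α) (hX : ∀ t, Measurable (X t)) (hstat : IsStationary P X)
    (hmax : IsMaxStable P X) (hfre : HasFrechetMargins P α X) {u : ℝ} (hu : 0 < u) (i j : ℤ) :
    cov[exceedInd X u {i}, exceedInd X u {j}; P]
      = Real.exp (-(pairCoeff P X (j - i) * u ^ (-α))) - Real.exp (-(2 * u ^ (-α))) := by
  have hs : ∀ i, P.real (allExceed X u {i}) = 1 - Real.exp (-(u ^ (-α))) := fun i => by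
    simpa [allExceed] using prob_exceed hX hfre hu i
  have hc : ∀ i, MeasurableSet {ω | X i ω ≤ u} := fun i =>
    measurableSet_le (hX i) measurable_const
  have hle : ∀ i, P.real {ω | X i ω ≤ u} = Real.exp (-(u ^ (-α))) := fun i => by
    rw [hfre i u, if_pos hu]
  have hinter : P.real ({ω | X i ω ≤ u} ∩ {ω | X j ω ≤ u})
      = Real.exp (-(pairCoeff P X (j - i) * u ^ (-α))) := by
    rw [← extremalCoeff_pair hX hstat, ← cdf_diag_eq_exp hα hX hmax hfre _ hu]
    congr 1
    ext ω
    simp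
  have hun := measureReal_union_add_inter (μ := P) (s := {ω | X i ω ≤ u}) (hc j)
  have hboth : P.real (allExceed X u ({i} ∪ {j}))
      = 1 - P.real ({ω | X i ω ≤ u} ∪ {ω | X j ω ≤ u}) := by
    rw [← probReal_compl_eq_one_sub ((hc i).union (hc j))]
    congr 1
    ext ω
    simp [allExceed]
  have hsq : Real.exp (-(2 * u ^ (-α))) = Real.exp (-(u ^ (-α))) * Real.exp (-(u ^ (-α))) := by
    rw [← Real.exp_add]; ring_nf
  rw [covariance_exceedInd hX, hs, hs, hboth, hsq, ← hinter]
  rw [hle, hle] at hun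
  linear_combination -hun

lemma extremalCoeff_nonneg (S : Finset ℤ) : 0 ≤ extremalCoeff P X S :=
  neg_nonneg.2 (Real.log_nonpos measureReal_nonneg measureReal_le_one)

lemma covariance_single_le (hα : 0 < α) (hX : ∀ t, Measurable (X t)) (hstat : IsStationary P X)
    (hmax : IsMaxStable P X) (hfre : HasFrechetMargins P α X) {u : ℝ} (hu : 0 < u) (i j : ℤ) :
    cov[exceedInd X u {i}, exceedInd X u {j}; P] ≤ (2 - pairCoeff P X (j - i)) * u ^ (-α) := by
  have h0 := covariance_exceedInd_nonneg hα hX hmax hfre hu {i} {j}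
  rw [covariance_single hα hX hstat hmax hfre hu] at h0 ⊢
  set θ := pairCoeff P X (j - i)
  set x := u ^ (-α)
  have hx : 0 ≤ x := by positivity
  have hθ : 0 ≤ θ := extremalCoeff_nonneg _
  have e : Real.exp (-(2 * x)) = Real.exp (-(θ * x)) * Real.exp (-((2 - θ) * x)) := by
    rw [← Real.exp_add]; ring_nf
  have h1 : Real.exp (-(θ * x)) ≤ 1 := Real.exp_le_one_iff.2 (by nlinarith)
  have h2 := Real.add_one_le_exp (-((2 - θ) * x))
  have h3 := Real.exp_pos (-(θ * x))
  have h4 : Real.exp (-((2 - θ) * x)) ≤ 1 := by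
    rw [e] at h0
    by_contra hc
    nlinarith
  rw [e]
  nlinarith

/-- The exponent measure of the event that all coordinates in `S` are large, by
inclusion-exclusion from the extremal coefficients. -/
noncomputable def tailCoeff (P : Measure Ω) (X : ℤ → Ω → ℝ) (S : Finset ℤ) : ℝ :=
  ∑ A ∈ S.powerset with A.Nonempty, (-1 : ℝ) ^ (A.card + 1) * extremalCoeff P X A

lemma sum_neg_one_pow_nonempty {S : Finset ℤ} (hS : S.Nonempty) :
    ∑ A ∈ S.powerset with A.Nonempty, (-1 : ℝ) ^ (A.card + 1) = 1 := by
  have h := congrArg (Int.cast (R := ℝ)) (Finset.sum_powerset_neg_one_pow_card_of_nonempty hS)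
  push_cast at h
  rw [← Finset.sum_filter_add_sum_filter_not S.powerset (fun A => A.Nonempty)] at h
  have e : S.powerset.filter (fun A => ¬ A.Nonempty) = {∅} := by
    ext A
    simp only [Finset.mem_filter, Finset.mem_powerset, Finset.not_nonempty_iff_eq_empty,
      Finset.mem_singleton]
    exact ⟨fun h => h.2, fun h => ⟨h ▸ Finset.empty_subset S, h⟩⟩
  rw [e, Finset.sum_singleton, Finset.card_empty, pow_zero] at h
  simp only [pow_succ, mul_neg, mul_one, Finset.sum_neg_distrib]
  linarith

lemma prob_allExceed_eq (hα : 0 < α) (hX : ∀ t, Measurable (X t)) (hmax : IsMaxStable P X)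
    (hfre : HasFrechetMargins P α X) {S : Finset ℤ} (hS : S.Nonempty) {u : ℝ} (hu : 0 < u) :
    P.real (allExceed X u S) = ∑ A ∈ S.powerset with A.Nonempty,
      (-1 : ℝ) ^ (A.card + 1) * (1 - Real.exp (-(extremalCoeff P X A * u ^ (-α)))) := by
  have hc : ∀ i ∈ S, MeasurableSet {ω | X i ω ≤ u} := fun i _ =>
    measurableSet_le (hX i) measurable_const
  have h := measureReal_biUnion_eq_sum_powerset (μ := P) hc
  have e : P.real (allExceed X u S) = 1 - P.real (⋃ i ∈ S, {ω | X i ω ≤ u}) := by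
    rw [← probReal_compl_eq_one_sub (S.measurableSet_biUnion hc)]
    congr 1
    ext ω
    simp [allExceed]
  have e2 : ∀ A : Finset ℤ, P.real (⋂ i ∈ A, {ω | X i ω ≤ u})
      = Real.exp (-(extremalCoeff P X A * u ^ (-α))) := by
    intro A
    rw [← cdf_diag_eq_exp hα hX hmax hfre A hu]
    congr 1
    ext ω
    simp
  simp only [e2] at h
  simp only [mul_sub, mul_one, Finset.sum_sub_distrib]
  rw [e, h, sum_neg_one_pow_nonempty hS]

lemma abs_one_sub_exp_neg_sub_le {y : ℝ} (hy : 0 ≤ y) : |1 - Real.exp (-y) - y| ≤ y ^ 2 := by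
  have h1 := Real.add_one_le_exp (-y)
  have h2 := Real.add_one_le_exp y
  have h3 : Real.exp (-y) * Real.exp y = 1 := by rw [← Real.exp_add]; simp
  have h4 := Real.exp_pos (-y)
  have h5 : Real.exp (-y) * (1 + y) ≤ 1 := by nlinarith
  rw [abs_le]
  constructor
  · by_contra hc
    have : 1 - y + y ^ 2 < Real.exp (-y) := by linarith
    have h6 : (1 - y + y ^ 2) * (1 + y) < Real.exp (-y) * (1 + y) :=
      mul_lt_mul_of_pos_right this (by linarith)
    have h7 : (1 - y + y ^ 2) * (1 + y) = 1 + y ^ 3 := by ring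
    have h8 : 0 ≤ y ^ 3 := by positivity
    linarith
  · nlinarith [sq_nonneg y]

lemma tendsto_rpow_neg (hα : 0 < α) : Tendsto (fun u : ℝ => u ^ (-α)) atTop (𝓝 0) :=
  tendsto_rpow_neg_atTop hα

lemma half_rpow_le_exceedProb (hX : ∀ t, Measurable (X t)) (hfre : HasFrechetMargins P α X)
    {u : ℝ} (hu : 0 < u) (hx : u ^ (-α) ≤ 1 / 2) : u ^ (-α) / 2 ≤ exceedProb P X u := by
  rw [exceedProb_eq hX hfre hu]
  have hx0 : 0 < u ^ (-α) := by positivity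
  have := (abs_le.1 (abs_one_sub_exp_neg_sub_le hx0.le)).1
  nlinarith

lemma tendsto_exceedProb (hα : 0 < α) (hX : ∀ t, Measurable (X t))
    (hfre : HasFrechetMargins P α X) : Tendsto (exceedProb P X) atTop (𝓝 0) := by
  refine squeeze_zero' (Eventually.of_forall fun _ => measureReal_nonneg) ?_ (tendsto_rpow_neg hα)
  filter_upwards [eventually_gt_atTop 0] with u hu using prob_exceed_le hX hfre hu 0

lemma exceedProb_pos (hX : ∀ t, Measurable (X t)) (hfre : HasFrechetMargins P α X)
    {u : ℝ} (hu : 0 < u) : 0 < exceedProb P X u := by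
  rw [exceedProb_eq hX hfre hu, sub_pos, Real.exp_lt_one_iff]
  simpa using Real.rpow_pos_of_pos hu _

/-- The ratio of a joint exceedance probability to `p(u)` converges at the rate `p(u)`. -/
lemma abs_prob_allExceed_div_sub_le (hα : 0 < α) (hX : ∀ t, Measurable (X t))
    (hmax : IsMaxStable P X) (hfre : HasFrechetMargins P α X) {S : Finset ℤ} (hS : S.Nonempty) :
    ∃ C, ∀ᶠ u in atTop,
      |P.real (allExceed X u S) / exceedProb P X u - tailCoeff P X S| ≤ C * exceedProb P X u := by
  refine ⟨4 * ((∑ A ∈ S.powerset with A.Nonempty, extremalCoeff P X A ^ 2)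
    + |tailCoeff P X S|), ?_⟩
  filter_upwards [eventually_gt_atTop 0, (tendsto_rpow_neg hα).eventually_le_const
    (show (0 : ℝ) < 1 / 2 by norm_num)] with u hu hx
  have hp := exceedProb_pos hX hfre hu
  have hxp := half_rpow_le_exceedProb hX hfre hu hx
  have hpe := exceedProb_eq hX hfre hu
  set p := exceedProb P X u
  set x := u ^ (-α)
  have hx0 : 0 < x := by positivity
  have hxp2 : |p - x| ≤ x ^ 2 := by rw [hpe]; exact abs_one_sub_exp_neg_sub_le hx0.le
  have h1 : |P.real (allExceed X u S) - tailCoeff P X S * x|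
      ≤ (∑ A ∈ S.powerset with A.Nonempty, extremalCoeff P X A ^ 2) * x ^ 2 := by
    rw [prob_allExceed_eq hα hX hmax hfre hS hu, tailCoeff, Finset.sum_mul, Finset.sum_mul,
      ← Finset.sum_sub_distrib]
    refine (Finset.abs_sum_le_sum_abs _ _).trans (Finset.sum_le_sum fun A _ => ?_)
    rw [mul_assoc, ← mul_sub, abs_mul, abs_pow, abs_neg, abs_one, one_pow, one_mul, ← mul_pow]
    exact abs_one_sub_exp_neg_sub_le (mul_nonneg (extremalCoeff_nonneg A) hx0.le)
  have h2 : |P.real (allExceed X u S) - tailCoeff P X S * p|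
      ≤ ((∑ A ∈ S.powerset with A.Nonempty, extremalCoeff P X A ^ 2)
        + |tailCoeff P X S|) * x ^ 2 := by
    have e : P.real (allExceed X u S) - tailCoeff P X S * p
        = (P.real (allExceed X u S) - tailCoeff P X S * x) - tailCoeff P X S * (p - x) := by ring
    rw [e]
    refine (abs_sub _ _).trans ?_
    rw [abs_mul, add_mul]
    exact add_le_add h1 (mul_le_mul_of_nonneg_left hxp2 (abs_nonneg _))
  have e : P.real (allExceed X u S) / p - tailCoeff P X S
      = (P.real (allExceed X u S) - tailCoeff P X S * p) / p := by
    field_simp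
  rw [e, abs_div, abs_of_pos hp, div_le_iff₀ hp]
  refine h2.trans ?_
  have h3 : x ^ 2 ≤ 4 * p * p := by nlinarith
  have h4 : 0 ≤ (∑ A ∈ S.powerset with A.Nonempty, extremalCoeff P X A ^ 2)
      + |tailCoeff P X S| :=
    add_nonneg (Finset.sum_nonneg fun _ _ => sq_nonneg _) (abs_nonneg _)
  calc _ ≤ _ := mul_le_mul_of_nonneg_left h3 h4
    _ = _ := by ring

lemma tendsto_prob_allExceed_div (hα : 0 < α) (hX : ∀ t, Measurable (X t))
    (hmax : IsMaxStable P X) (hfre : HasFrechetMargins P α X) {S : Finset ℤ} (hS : S.Nonempty) :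
    Tendsto (fun u => P.real (allExceed X u S) / exceedProb P X u) atTop
      (𝓝 (tailCoeff P X S)) := by
  obtain ⟨C, hC⟩ := abs_prob_allExceed_div_sub_le hα hX hmax hfre hS
  rw [tendsto_iff_norm_sub_tendsto_zero]
  refine squeeze_zero' (Eventually.of_forall fun _ => norm_nonneg _) hC ?_
  simpa using (tendsto_exceedProb hα hX hfre).const_mul C

/-- Limiting covariances, relative to `p(u)`, of joint exceedances. -/
lemma tendsto_covariance_div (hα : 0 < α) (hX : ∀ t, Measurable (X t))
    (hmax : IsMaxStable P X) (hfre : HasFrechetMargins P α X) {S S' : Finset ℤ}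
    (hS : S.Nonempty) (hS' : S'.Nonempty) :
    Tendsto (fun u => cov[exceedInd X u S, exceedInd X u S'; P] / exceedProb P X u) atTop
      (𝓝 (tailCoeff P X (S ∪ S'))) := by
  have h1 := tendsto_prob_allExceed_div hα hX hmax hfre (hS.mono (Finset.subset_union_left
    (s₂ := S')))
  have h2 := ((tendsto_prob_allExceed_div hα hX hmax hfre hS).mul
    (tendsto_prob_allExceed_div hα hX hmax hfre hS')).mul (tendsto_exceedProb hα hX hfre)
  rw [mul_zero] at h2
  have h3 := h1.sub h2
  rw [sub_zero] at h3
  refine h3.congr' ?_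
  filter_upwards [eventually_gt_atTop 0] with u hu
  have hp := exceedProb_pos hX hfre hu
  rw [covariance_exceedInd hX]
  field_simp

end Covariance

/-! ### Characteristic functions of sums of associated variables -/

/-- A random element `Z` of an ordered set is associated if any two monotone real functions of it
are nonnegatively correlated. All real functions of `Z` are required to be square integrable, as
is the case for the finitely valued `Z` used below. -/
structure IsAssociated {β : Type*} [Preorder β] (P : Measure Ω) (Z : Ω → β) : Prop where
  memLp : ∀ φ : β → ℝ, MemLp (fun ω => φ (Z ω)) 2 P
  cov_nonneg : ∀ φ ψ : β → ℝ, Monotone φ → Monotone ψ →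
    0 ≤ cov[fun ω => φ (Z ω), fun ω => ψ (Z ω); P]

/-- The characteristic function of a real random variable. -/
noncomputable def chf (P : Measure Ω) (s : ℝ) (U : Ω → ℝ) : ℂ :=
  ∫ ω, Complex.exp ((s * U ω : ℝ) * Complex.I) ∂P

section Newman

variable {β : Type*} [Preorder β] {P : Measure Ω} [IsProbabilityMeasure P] {Z : Ω → β}

/-- Composition with Lipschitz functions: `K φ ± f ∘ φ` is monotone if `f` is `K`-Lipschitz. -/
lemma IsAssociated.abs_cov_comp_le (hZ : IsAssociated P Z) {φ ψ : β → ℝ} (hφ : Monotone φ)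
    (hψ : Monotone ψ) {K : ℝ} {f g : ℝ → ℝ} (hf : ∀ x y, |f x - f y| ≤ K * |x - y|)
    (hg : ∀ x y, |g x - g y| ≤ K * |x - y|) :
    |cov[fun ω => f (φ (Z ω)), fun ω => g (ψ (Z ω)); P]|
      ≤ K ^ 2 * cov[fun ω => φ (Z ω), fun ω => ψ (Z ω); P] := by
  have mono : ∀ {χ : β → ℝ} {h : ℝ → ℝ} (ε : ℝ), |ε| = 1 → Monotone χ →
      (∀ x y, |h x - h y| ≤ K * |x - y|) → Monotone (fun b => K * χ b + ε * h (χ b)) := by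
    intro χ h ε hε hχ hh a b hab
    have h1 := hh (χ b) (χ a)
    rw [abs_of_nonneg (sub_nonneg.2 (hχ hab))] at h1
    have h2 : |ε * (h (χ b) - h (χ a))| ≤ K * (χ b - χ a) := by
      rwa [abs_mul, hε, one_mul]
    have := (abs_le.1 h2).1
    change K * χ a + ε * h (χ a) ≤ K * χ b + ε * h (χ b)
    linarith
  have key : ∀ ε δ : ℝ, |ε| = 1 → |δ| = 1 →
      0 ≤ K ^ 2 * cov[fun ω => φ (Z ω), fun ω => ψ (Z ω); P]
        + K * δ * cov[fun ω => φ (Z ω), fun ω => g (ψ (Z ω)); P]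
        + ε * K * cov[fun ω => f (φ (Z ω)), fun ω => ψ (Z ω); P]
        + ε * δ * cov[fun ω => f (φ (Z ω)), fun ω => g (ψ (Z ω)); P] := by
    intro ε δ hε hδ
    have h := hZ.cov_nonneg _ _ (mono ε hε hφ hf) (mono δ hδ hψ hg)
    have e1 := covariance_add_left (hZ.memLp (fun b => K * φ b)) (hZ.memLp (fun b => ε * f (φ b)))
      (hZ.memLp (fun b => K * ψ b + δ * g (ψ b)))
    have e2 := covariance_add_right (hZ.memLp (fun b => K * φ b)) (hZ.memLp (fun b => K * ψ b))
      (hZ.memLp (fun b => δ * g (ψ b)))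
    have e3 := covariance_add_right (hZ.memLp (fun b => ε * f (φ b)))
      (hZ.memLp (fun b => K * ψ b)) (hZ.memLp (fun b => δ * g (ψ b)))
    have h' : 0 ≤ cov[(fun ω => K * φ (Z ω)) + (fun ω => ε * f (φ (Z ω))),
      fun ω => K * ψ (Z ω) + δ * g (ψ (Z ω)); P] := h
    rw [e1] at h'
    have e2' : cov[fun ω => K * φ (Z ω), fun ω => K * ψ (Z ω) + δ * g (ψ (Z ω)); P] = _ := e2
    have e3' : cov[fun ω => ε * f (φ (Z ω)), fun ω => K * ψ (Z ω) + δ * g (ψ (Z ω)); P] = _ := e3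
    rw [e2', e3'] at h'
    simp only [covariance_const_mul_left, covariance_const_mul_right] at h'
    linarith
  have k1 := key 1 1 (by simp) (by simp)
  have k2 := key (-1) (-1) (by simp) (by simp)
  have k3 := key 1 (-1) (by simp) (by simp)
  have k4 := key (-1) 1 (by simp) (by simp)
  rw [abs_le]
  constructor <;> linarith

lemma IsAssociated.integrable (hZ : IsAssociated P Z) (φ : β → ℝ) :
    Integrable (fun ω => φ (Z ω)) P := (hZ.memLp φ).integrable (by norm_num)

lemma IsAssociated.chf_eq (hZ : IsAssociated P Z) (s : ℝ) (φ : β → ℝ) :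
    chf P s (fun ω => φ (Z ω)) = ((∫ ω, Real.cos (s * φ (Z ω)) ∂P : ℝ) : ℂ)
      + ((∫ ω, Real.sin (s * φ (Z ω)) ∂P : ℝ) : ℂ) * Complex.I := by
  have h1 : Integrable (fun ω => ((Real.cos (s * φ (Z ω)) : ℝ) : ℂ)) P :=
    (hZ.integrable (fun b => Real.cos (s * φ b))).ofReal
  have h2 : Integrable (fun ω => ((Real.sin (s * φ (Z ω)) : ℝ) : ℂ)) P :=
    (hZ.integrable (fun b => Real.sin (s * φ b))).ofReal
  rw [← integral_complex_ofReal, ← integral_complex_ofReal, ← integral_mul_const,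
    ← integral_add h1 (h2.mul_const _)]
  refine integral_congr_ae (ae_of_all _ fun ω => ?_)
  change Complex.exp _ = ((Real.cos (s * φ (Z ω)) : ℝ) : ℂ)
    + ((Real.sin (s * φ (Z ω)) : ℝ) : ℂ) * Complex.I
  rw [Complex.exp_mul_I, Complex.ofReal_cos, Complex.ofReal_sin]

lemma abs_cos_mul_sub_le (s x y : ℝ) : |Real.cos (s * x) - Real.cos (s * y)| ≤ |s| * |x - y| := by
  rw [← abs_mul, mul_sub]
  exact Real.abs_cos_sub_cos_le _ _

lemma abs_sin_mul_sub_le (s x y : ℝ) : |Real.sin (s * x) - Real.sin (s * y)| ≤ |s| * |x - y| := by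
  rw [← abs_mul, mul_sub]
  exact Real.abs_sin_sub_sin_le _ _

/-- Newman's inequality for two monotone functions: their covariance controls the error made when
the characteristic function of the sum is factorized. -/
lemma IsAssociated.norm_chf_add_sub_le (hZ : IsAssociated P Z) {φ ψ : β → ℝ} (hφ : Monotone φ)
    (hψ : Monotone ψ) (s : ℝ) :
    ‖chf P s (fun ω => φ (Z ω) + ψ (Z ω))
      - chf P s (fun ω => φ (Z ω)) * chf P s (fun ω => ψ (Z ω))‖
      ≤ 4 * s ^ 2 * cov[fun ω => φ (Z ω), fun ω => ψ (Z ω); P] := by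
  have bound : ∀ f g : ℝ → ℝ, (∀ x y, |f x - f y| ≤ |s| * |x - y|) →
      (∀ x y, |g x - g y| ≤ |s| * |x - y|) →
      |∫ ω, f (φ (Z ω)) * g (ψ (Z ω)) ∂P - (∫ ω, f (φ (Z ω)) ∂P) * ∫ ω, g (ψ (Z ω)) ∂P|
        ≤ s ^ 2 * cov[fun ω => φ (Z ω), fun ω => ψ (Z ω); P] := by
    intro f g hf hg
    have h := hZ.abs_cov_comp_le hφ hψ hf hg
    rw [covariance_eq_sub (hZ.memLp fun b => f (φ b)) (hZ.memLp fun b => g (ψ b)), sq_abs] at h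
    exact h
  have cc := bound _ _ (abs_cos_mul_sub_le s) (abs_cos_mul_sub_le s)
  have ss := bound _ _ (abs_sin_mul_sub_le s) (abs_sin_mul_sub_le s)
  have cs := bound _ _ (abs_cos_mul_sub_le s) (abs_sin_mul_sub_le s)
  have sc := bound _ _ (abs_sin_mul_sub_le s) (abs_cos_mul_sub_le s)
  have e1 : ∫ ω, Real.cos (s * (φ (Z ω) + ψ (Z ω))) ∂P
      = ∫ ω, Real.cos (s * φ (Z ω)) * Real.cos (s * ψ (Z ω)) ∂P
        - ∫ ω, Real.sin (s * φ (Z ω)) * Real.sin (s * ψ (Z ω)) ∂P := by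
    rw [← integral_sub (hZ.integrable fun b => Real.cos (s * φ b) * Real.cos (s * ψ b))
      (hZ.integrable fun b => Real.sin (s * φ b) * Real.sin (s * ψ b))]
    simp_rw [mul_add, Real.cos_add]
  have e2 : ∫ ω, Real.sin (s * (φ (Z ω) + ψ (Z ω))) ∂P
      = ∫ ω, Real.sin (s * φ (Z ω)) * Real.cos (s * ψ (Z ω)) ∂P
        + ∫ ω, Real.cos (s * φ (Z ω)) * Real.sin (s * ψ (Z ω)) ∂P := by
    rw [← integral_add (hZ.integrable fun b => Real.sin (s * φ b) * Real.cos (s * ψ b))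
      (hZ.integrable fun b => Real.cos (s * φ b) * Real.sin (s * ψ b))]
    simp_rw [mul_add, Real.sin_add]
  rw [hZ.chf_eq s φ, hZ.chf_eq s ψ, hZ.chf_eq s (fun b => φ b + ψ b), e1, e2]
  refine (Complex.norm_le_abs_re_add_abs_im _).trans ?_
  simp only [Complex.sub_re, Complex.sub_im, Complex.add_re, Complex.add_im, Complex.mul_re,
    Complex.mul_im, Complex.ofReal_re, Complex.ofReal_im, Complex.I_re, Complex.I_im, mul_zero,
    mul_one, add_zero, zero_add, sub_zero]
  rw [abs_le] at cc ss cs sc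
  have r1 := fun {a b : ℝ} (h1 : -b ≤ a) (h2 : a ≤ b) => abs_le.2 ⟨h1, h2⟩
  refine (add_le_add (r1 (b := 2 * (s ^ 2 * cov[fun ω => φ (Z ω), fun ω => ψ (Z ω); P])) ?_ ?_)
    (r1 (b := 2 * (s ^ 2 * cov[fun ω => φ (Z ω), fun ω => ψ (Z ω); P])) ?_ ?_)).trans
    (le_of_eq (by ring)) <;> linarith [cc.1, cc.2, ss.1, ss.2, cs.1, cs.2, sc.1, sc.2]

end Newman

lemma norm_exp_mul_I_sub_taylor_le {y : ℝ} (hy : |y| ≤ 1) :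
    ‖Complex.exp (y * Complex.I) - (1 + y * Complex.I - (y : ℂ) ^ 2 / 2)‖ ≤ |y| ^ 3 := by
  have hn : ‖(y : ℂ) * Complex.I‖ = |y| := by simp
  have h := Complex.exp_bound (x := y * Complex.I) (by rw [hn]; exact hy) (n := 3) (by norm_num)
  have e : ∑ m ∈ Finset.range 3, ((y : ℂ) * Complex.I) ^ m / (m.factorial : ℂ)
      = 1 + y * Complex.I - (y : ℂ) ^ 2 / 2 := by
    simp [Finset.sum_range_succ, Nat.factorial, mul_pow, Complex.I_sq]
    ring
  rw [e, hn] at h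
  refine h.trans ?_
  have h0 : 0 ≤ |y| ^ 3 := by positivity
  norm_num [Nat.factorial]
  nlinarith

/-- A small centred variable has nearly a Gaussian characteristic function. -/
lemma norm_chf_sub_exp_le {P : Measure Ω} [IsProbabilityMeasure P] {U : Ω → ℝ}
    (hU : Measurable U) {K s : ℝ} (hK : ∀ ω, |U ω| ≤ K) (hsK : |s| * K ≤ 1)
    (h0 : ∫ ω, U ω ∂P = 0) :
    ‖chf P s U - (Real.exp (-(s ^ 2 / 2 * Var[U; P])) : ℂ)‖ ≤ 2 * |s| ^ 3 * K * Var[U; P] := by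
  have hvar : Var[U; P] = ∫ ω, U ω ^ 2 ∂P := by
    rw [variance_of_integral_eq_zero hU.aemeasurable h0]
  have hbd : ∀ n : ℕ, Integrable (fun ω => U ω ^ n) P := fun n =>
    Integrable.of_bound (hU.pow_const n).aestronglyMeasurable (K ^ n) (ae_of_all _ fun ω => by
      rw [norm_pow, Real.norm_eq_abs]
      exact pow_le_pow_left₀ (abs_nonneg _) (hK ω) n)
  have hI : Integrable U P := by simpa using hbd 1
  obtain ⟨ω₀⟩ : Nonempty Ω := nonempty_of_isProbabilityMeasure P
  have hK0 : 0 ≤ K := (abs_nonneg _).trans (hK ω₀)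
  set v := Var[U; P] with hv
  have hv0 : 0 ≤ v := variance_nonneg _ _
  have hvK : v ≤ K ^ 2 := by
    rw [hvar]
    calc ∫ ω, U ω ^ 2 ∂P ≤ ∫ _, K ^ 2 ∂P := integral_mono (hbd 2) (integrable_const _) fun ω => by
          simpa using pow_le_pow_left₀ (abs_nonneg _) (hK ω) 2
      _ = K ^ 2 := by simp
  have hexp : Integrable (fun ω => Complex.exp ((s * U ω : ℝ) * Complex.I)) P := by
    refine Integrable.of_bound (by fun_prop) 1 (ae_of_all _ fun ω => ?_)
    rw [Complex.norm_exp_ofReal_mul_I]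
  have htay : ∫ ω, (1 + ((s * U ω : ℝ) : ℂ) * Complex.I - ((s * U ω : ℝ) : ℂ) ^ 2 / 2) ∂P
      = ((1 - s ^ 2 / 2 * v : ℝ) : ℂ) := by
    have i1 : Integrable (fun ω => ((s * U ω : ℝ) : ℂ) * Complex.I) P :=
      ((hI.const_mul s).ofReal).mul_const _
    have i2 : Integrable (fun ω => ((s ^ 2 / 2 * U ω ^ 2 : ℝ) : ℂ)) P :=
      ((hbd 2).const_mul _).ofReal
    have e : ∀ ω, (1 + ((s * U ω : ℝ) : ℂ) * Complex.I - ((s * U ω : ℝ) : ℂ) ^ 2 / 2)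
        = 1 + ((s * U ω : ℝ) : ℂ) * Complex.I - ((s ^ 2 / 2 * U ω ^ 2 : ℝ) : ℂ) := by
      intro ω; push_cast; ring
    simp_rw [e]
    have i0 : Integrable (fun _ : Ω => (1 : ℂ)) P := integrable_const _
    have i3 : Integrable (fun ω => 1 + ((s * U ω : ℝ) : ℂ) * Complex.I) P := i0.add i1
    rw [integral_sub i3 i2, integral_add i0 i1,
      integral_mul_const, integral_complex_ofReal, integral_complex_ofReal, integral_const_mul,
      integral_const_mul,
      h0, ← hvar]
    simp
  have h1 : ‖chf P s U - ((1 - s ^ 2 / 2 * v : ℝ) : ℂ)‖ ≤ |s| ^ 3 * K * v := by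
    rw [← htay, chf, ← integral_sub hexp]
    · refine (norm_integral_le_integral_norm _).trans ?_
      calc ∫ ω, ‖Complex.exp ((s * U ω : ℝ) * Complex.I)
            - (1 + ((s * U ω : ℝ) : ℂ) * Complex.I - ((s * U ω : ℝ) : ℂ) ^ 2 / 2)‖ ∂P
          ≤ ∫ ω, |s| ^ 3 * K * U ω ^ 2 ∂P := by
            refine integral_mono_of_nonneg (ae_of_all _ fun _ => norm_nonneg _)
              ((hbd 2).const_mul _) (ae_of_all _ fun ω => ?_)
            have hb : |s * U ω| ≤ 1 := by
              rw [abs_mul]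
              exact (mul_le_mul_of_nonneg_left (hK ω) (abs_nonneg _)).trans hsK
            refine (norm_exp_mul_I_sub_taylor_le hb).trans ?_
            have : |s * U ω| ^ 3 = |s| ^ 3 * (|U ω| * U ω ^ 2) := by
              rw [abs_mul, mul_pow, ← sq_abs (U ω)]; ring
            change _ ≤ |s| ^ 3 * K * U ω ^ 2
            rw [this, mul_assoc]
            exact mul_le_mul_of_nonneg_left
              (mul_le_mul_of_nonneg_right (hK ω) (sq_nonneg _)) (by positivity)
        _ = |s| ^ 3 * K * v := by rw [integral_const_mul, ← hvar]
    · refine Integrable.of_bound (by fun_prop) 3 (ae_of_all _ fun ω => ?_)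
      have hb : |s * U ω| ≤ 1 := by
        rw [abs_mul]
        exact (mul_le_mul_of_nonneg_left (hK ω) (abs_nonneg _)).trans hsK
      refine (norm_sub_le _ _).trans ?_
      refine (add_le_add_left (norm_add_le _ _) _).trans ?_
      rw [norm_mul, norm_div, norm_pow, Complex.norm_real, Complex.norm_I, norm_one,
        Real.norm_eq_abs]
      have : |s * U ω| ^ 2 ≤ 1 := pow_le_one₀ (abs_nonneg _) hb
      rw [Complex.norm_two]
      linarith
  have h2 : ‖((1 - s ^ 2 / 2 * v : ℝ) : ℂ) - (Real.exp (-(s ^ 2 / 2 * v)) : ℂ)‖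
      ≤ |s| ^ 3 * K * v := by
    rw [← Complex.ofReal_sub, Complex.norm_real, Real.norm_eq_abs]
    have h3 := abs_one_sub_exp_neg_sub_le (y := s ^ 2 / 2 * v) (by positivity)
    rw [show 1 - s ^ 2 / 2 * v - Real.exp (-(s ^ 2 / 2 * v))
      = 1 - Real.exp (-(s ^ 2 / 2 * v)) - s ^ 2 / 2 * v by ring]
    refine h3.trans ?_
    have hs : s ^ 2 = |s| ^ 2 := (sq_abs s).symm
    have hsK0 : 0 ≤ |s| * K := by positivity
    calc (s ^ 2 / 2 * v) ^ 2 = |s| ^ 4 / 4 * v * v := by rw [hs]; ring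
      _ ≤ |s| ^ 4 / 4 * v * K ^ 2 := mul_le_mul_of_nonneg_left hvK (by positivity)
      _ = |s| ^ 3 * K * v * ((|s| * K) / 4) := by ring
      _ ≤ |s| ^ 3 * K * v * 1 := mul_le_mul_of_nonneg_left (by linarith) (by positivity)
      _ = |s| ^ 3 * K * v := mul_one _
  calc _ ≤ ‖chf P s U - ((1 - s ^ 2 / 2 * v : ℝ) : ℂ)‖
        + ‖((1 - s ^ 2 / 2 * v : ℝ) : ℂ) - (Real.exp (-(s ^ 2 / 2 * v)) : ℂ)‖ :=
        norm_sub_le_norm_sub_add_norm_sub _ _ _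
    _ ≤ _ := by linarith

lemma norm_chf_le_one {P : Measure Ω} [IsProbabilityMeasure P] (s : ℝ) (U : Ω → ℝ) :
    ‖chf P s U‖ ≤ 1 := by
  refine (norm_integral_le_integral_norm _).trans ?_
  simp [Complex.norm_exp_ofReal_mul_I, -Complex.ofReal_mul]

lemma norm_chf_sub_chf_le {P : Measure Ω} [IsProbabilityMeasure P] {U V : Ω → ℝ}
    (hU : Measurable U) (hV : Measurable V) {s ε : ℝ} (h : ∀ ω, |U ω - V ω| ≤ ε) :
    ‖chf P s U - chf P s V‖ ≤ |s| * ε := by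
  have hexp : ∀ W : Ω → ℝ, Measurable W →
      Integrable (fun ω => Complex.exp ((s * W ω : ℝ) * Complex.I)) P := fun W hW => by
    refine Integrable.of_bound (by fun_prop) 1 (ae_of_all _ fun ω => ?_)
    rw [Complex.norm_exp_ofReal_mul_I]
  rw [chf, chf, ← integral_sub (hexp U hU) (hexp V hV)]
  refine (norm_integral_le_of_norm_le_const (C := |s| * ε) (ae_of_all _ fun ω => ?_)).trans
    (by simp)
  have e : Complex.exp ((s * U ω : ℝ) * Complex.I) - Complex.exp ((s * V ω : ℝ) * Complex.I)
      = Complex.exp ((s * V ω : ℝ) * Complex.I)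
        * (Complex.exp (Complex.I * (s * (U ω - V ω) : ℝ)) - 1) := by
    rw [mul_sub, ← Complex.exp_add, mul_one]
    congr 2
    push_cast
    ring
  rw [e, norm_mul, Complex.norm_exp_ofReal_mul_I, one_mul]
  refine Real.norm_exp_I_mul_ofReal_sub_one_le.trans ?_
  rw [Real.norm_eq_abs, abs_mul]
  exact mul_le_mul_of_nonneg_left (h ω) (abs_nonneg _)

/-- Gaussian approximation for a sum of small associated variables: the error is governed by the
sum of the covariances of distinct summands and by their size `K`. -/
lemma IsAssociated.norm_chf_sum_sub_exp_le {β : Type*} [Preorder β] {P : Measure Ω}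
    [IsProbabilityMeasure P] {Z : Ω → β} (hZ : IsAssociated P Z) {ψ : ℕ → β → ℝ} {K s : ℝ}
    (hmeas : ∀ j, Measurable (fun ω => ψ j (Z ω))) (hmono : ∀ j, Monotone (ψ j))
    (hsK : |s| * K ≤ 1) (m : ℕ) (hK : ∀ j < m, ∀ ω, |ψ j (Z ω)| ≤ K)
    (h0 : ∀ j < m, ∫ ω, ψ j (Z ω) ∂P = 0) :
    ‖chf P s (fun ω => ∑ j ∈ Finset.range m, ψ j (Z ω))
      - (Real.exp (-(s ^ 2 / 2 * ∑ j ∈ Finset.range m, Var[fun ω => ψ j (Z ω); P])) : ℂ)‖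
      ≤ 2 * s ^ 2 * (Var[fun ω => ∑ j ∈ Finset.range m, ψ j (Z ω); P]
          - ∑ j ∈ Finset.range m, Var[fun ω => ψ j (Z ω); P])
        + 2 * |s| ^ 3 * K * ∑ j ∈ Finset.range m, Var[fun ω => ψ j (Z ω); P] := by
  induction m with
  | zero =>
    have := variance_nonneg (fun _ : Ω => (0 : ℝ)) P
    simpa [chf] using by positivity
  | succ m ih =>
    have ih' := ih (fun j hj => hK j (hj.trans (Nat.lt_succ_self m)))
      (fun j hj => h0 j (hj.trans (Nat.lt_succ_self m)))
    have hb := norm_chf_sub_exp_le (P := P) (hmeas m) (hK m (Nat.lt_succ_self m)) hsK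
      (h0 m (Nat.lt_succ_self m))
    have hφ : Monotone (fun b => ∑ j ∈ Finset.range m, ψ j b) := fun a b hab =>
      Finset.sum_le_sum fun j _ => hmono j hab
    have hN := hZ.norm_chf_add_sub_le hφ (hmono m) s
    have hvar := variance_fun_add (hZ.memLp fun b => ∑ j ∈ Finset.range m, ψ j b) (hZ.memLp (ψ m))
    simp only [Finset.sum_range_succ]
    rw [hvar, mul_add, neg_add, Real.exp_add]
    set A := chf P s (fun ω => ∑ j ∈ Finset.range m, ψ j (Z ω))
    set B := chf P s (fun ω => ψ m (Z ω)) with hB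
    set C := chf P s (fun ω => ∑ j ∈ Finset.range m, ψ j (Z ω) + ψ m (Z ω))
    set V := ∑ j ∈ Finset.range m, Var[fun ω => ψ j (Z ω); P] with hV
    set v := Var[fun ω => ψ m (Z ω); P]
    set a := Real.exp (-(s ^ 2 / 2 * V))
    set b := Real.exp (-(s ^ 2 / 2 * v))
    have hV0 : 0 ≤ V := Finset.sum_nonneg fun _ _ => variance_nonneg _ _
    have ha : ‖(a : ℂ)‖ ≤ 1 := by
      rw [Complex.norm_real, Real.norm_of_nonneg (Real.exp_pos _).le, Real.exp_le_one_iff]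
      have : 0 ≤ s ^ 2 / 2 * V := by positivity
      linarith
    have hB1 : ‖B‖ ≤ 1 := norm_chf_le_one s _
    have e : C - ((a * b : ℝ) : ℂ) = (C - A * B) + (A - a) * B + a * (B - b) := by
      push_cast; ring
    rw [e]
    have n1 : ‖(A - a) * B‖ ≤ ‖A - a‖ := by
      rw [norm_mul]; exact mul_le_of_le_one_right (norm_nonneg _) hB1
    have n2 : ‖(a : ℂ) * (B - b)‖ ≤ ‖B - b‖ := by
      rw [norm_mul]; exact mul_le_of_le_one_left (norm_nonneg _) ha
    have := norm_add₃_le (a := C - A * B) (b := (A - a) * B) (c := (a : ℂ) * (B - b))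
    nlinarith

/-! ### Variances of exceedance counts -/

section Variance

variable {P : Measure Ω} {X : ℤ → Ω → ℝ} {α : ℝ}

/-- The covariance at lag `t` of the stationary sequence of joint exceedance indicators. -/
noncomputable def lagCov (P : Measure Ω) (X : ℤ → Ω → ℝ) (S : Finset ℤ) (u : ℝ) (t : ℤ) : ℝ :=
  cov[exceedInd X u S, exceedInd X u (shift S t); P]

/-- The limiting variance of normalized counts of joint exceedances at translates of `S`. -/
noncomputable def asympVar (P : Measure Ω) (X : ℤ → Ω → ℝ) (S : Finset ℤ) : ℝ :=
  tailCoeff P X S + 2 * ∑' t : ℕ, tailCoeff P X (S ∪ shift S ((t : ℤ) + 1))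

lemma shift_zero (S : Finset ℤ) : shift S 0 = S := by simp [shift]

lemma shift_nonempty {S : Finset ℤ} (hS : S.Nonempty) (t : ℤ) : (shift S t).Nonempty :=
  hS.image _

lemma shift_union_shift (S : Finset ℤ) (a b : ℤ) :
    shift S a ∪ shift S b = shift (S ∪ shift S (b - a)) a := by
  unfold shift
  rw [Finset.image_union, Finset.image_image]
  congr 2
  ext t
  simp only [Function.comp]
  ring

/-- A bound, uniform in the level, for the lagged covariances relative to `p(u)`. -/
noncomputable def lagBound (P : Measure Ω) (X : ℤ → Ω → ℝ) (S : Finset ℤ) (t : ℤ) : ℝ :=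
  ∑ i ∈ S, ∑ j ∈ S, 2 * (2 - pairCoeff P X (t + (j - i)))

lemma summable_lagBound (hX : ∀ t, Measurable (X t)) (hstat : IsStationary P X)
    (hsrd : Summable (fun t : ℕ => 2 - pairCoeff P X ((t : ℤ) + 1))) (S : Finset ℤ) :
    Summable (fun t : ℕ => lagBound P X S ((t : ℤ) + 1)) := by
  have h := summable_two_sub_pairCoeff hX hstat hsrd
  refine summable_sum fun i _ => summable_sum fun j _ => Summable.mul_left 2 ?_
  exact h.comp_injective (i := fun t : ℕ => (t : ℤ) + 1 + (j - i)) fun a b hab => by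
    simpa using hab

variable [IsProbabilityMeasure P]

lemma covariance_shift (hX : ∀ t, Measurable (X t)) (hstat : IsStationary P X) (u : ℝ)
    (S : Finset ℤ) (a b : ℤ) :
    cov[exceedInd X u (shift S a), exceedInd X u (shift S b); P] = lagCov P X S u (b - a) := by
  rw [lagCov, covariance_exceedInd hX, covariance_exceedInd hX, shift_union_shift,
    prob_allExceed_shift hX hstat, prob_allExceed_shift hX hstat, prob_allExceed_shift hX hstat,
    prob_allExceed_shift hX hstat]

lemma variance_sum_exceedInd (hX : ∀ t, Measurable (X t)) (hstat : IsStationary P X) (u : ℝ)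
    (S : Finset ℤ) (a : ℤ) (l : ℕ) :
    Var[fun ω => ∑ i ∈ Finset.range l, exceedInd X u (shift S (a + i)) ω; P]
      = l * lagCov P X S u 0
        + 2 * ∑ t ∈ Finset.range l, ((l : ℝ) - (t + 1)) * lagCov P X S u (t + 1) := by
  induction l with
  | zero =>
    simp only [Finset.range_zero, Finset.sum_empty, Nat.cast_zero, zero_mul, mul_zero, add_zero]
    exact variance_zero P
  | succ l ih =>
    have hm : ∀ i : ℕ, MemLp (exceedInd X u (shift S (a + i))) 2 P := fun i =>
      memLp_exceedInd hX u _
    simp only [Finset.sum_range_succ]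
    rw [variance_fun_add (memLp_finsetSum _ fun i _ => hm i) (hm l), ih,
      covariance_fun_sum_left' (fun i _ => hm i) (hm l),
      ← covariance_self (measurable_exceedInd hX u _).aemeasurable, covariance_shift hX hstat,
      sub_self]
    have e : ∑ i ∈ Finset.range l,
        cov[exceedInd X u (shift S (a + i)), exceedInd X u (shift S (a + l)); P]
        = ∑ t ∈ Finset.range l, lagCov P X S u (t + 1) := by
      rw [← Finset.sum_range_reflect (fun t : ℕ => lagCov P X S u (t + 1))]
      refine Finset.sum_congr rfl fun i hi => ?_
      rw [covariance_shift hX hstat]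
      congr 1
      have := Finset.mem_range.1 hi
      omega
    rw [e]
    have e2 : ∑ t ∈ Finset.range l, (((l + 1 : ℕ) : ℝ) - (t + 1)) * lagCov P X S u (t + 1)
        = ∑ t ∈ Finset.range l, ((l : ℝ) - (t + 1)) * lagCov P X S u (t + 1)
          + ∑ t ∈ Finset.range l, lagCov P X S u (t + 1) := by
      rw [← Finset.sum_add_distrib]
      refine Finset.sum_congr rfl fun t _ => ?_
      push_cast
      ring
    rw [e2]
    push_cast
    ring

lemma pairCoeff_le_two (hα : 0 < α) (hX : ∀ t, Measurable (X t)) (hstat : IsStationary P X)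
    (hmax : IsMaxStable P X) (hfre : HasFrechetMargins P α X) (h : ℤ) : pairCoeff P X h ≤ 2 := by
  have h0 := covariance_exceedInd_nonneg hα hX hmax hfre one_pos {0} {h}
  rw [covariance_single hα hX hstat hmax hfre one_pos, sub_nonneg, Real.exp_le_exp] at h0
  simpa using h0

lemma lagCov_nonneg (hα : 0 < α) (hX : ∀ t, Measurable (X t)) (hmax : IsMaxStable P X)
    (hfre : HasFrechetMargins P α X) {u : ℝ} (hu : 0 < u) (S : Finset ℤ) (t : ℤ) :
    0 ≤ lagCov P X S u t := covariance_exceedInd_nonneg hα hX hmax hfre hu _ _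

lemma lagCov_div_le (hα : 0 < α) (hX : ∀ t, Measurable (X t)) (hstat : IsStationary P X)
    (hmax : IsMaxStable P X) (hfre : HasFrechetMargins P α X) {u : ℝ} (hu : 0 < u)
    (hx : u ^ (-α) ≤ 1 / 2) (S : Finset ℤ) (t : ℤ) :
    lagCov P X S u t / exceedProb P X u ≤ lagBound P X S t := by
  rw [div_le_iff₀ (exceedProb_pos hX hfre hu)]
  refine (covariance_exceedInd_le_sum hα hX hmax hfre hu _ _).trans ?_
  rw [lagBound, Finset.sum_mul]
  refine Finset.sum_le_sum fun i _ => ?_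
  rw [shift, Finset.sum_image (fun a _ b _ hab => by simpa using hab), Finset.sum_mul]
  refine Finset.sum_le_sum fun j _ => ?_
  refine (covariance_single_le hα hX hstat hmax hfre hu _ _).trans ?_
  rw [show j + t - i = t + (j - i) by ring]
  have h1 := pairCoeff_le_two hα hX hstat hmax hfre (t + (j - i))
  have h2 := half_rpow_le_exceedProb hX hfre hu hx
  nlinarith

lemma eventually_level (hα : 0 < α) :
    ∀ᶠ u : ℝ in atTop, 0 < u ∧ u ^ (-α) ≤ 1 / 2 :=
  (eventually_gt_atTop 0).and ((tendsto_rpow_neg hα).eventually_le_const (by norm_num))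

lemma tendsto_lagCov_div (hα : 0 < α) (hX : ∀ t, Measurable (X t)) (hmax : IsMaxStable P X)
    (hfre : HasFrechetMargins P α X) {S : Finset ℤ} (hS : S.Nonempty) (t : ℤ) :
    Tendsto (fun u => lagCov P X S u t / exceedProb P X u) atTop
      (𝓝 (tailCoeff P X (S ∪ shift S t))) :=
  tendsto_covariance_div hα hX hmax hfre hS (shift_nonempty hS t)

lemma summable_tailCoeff (hα : 0 < α) (hX : ∀ t, Measurable (X t)) (hstat : IsStationary P X)
    (hmax : IsMaxStable P X) (hfre : HasFrechetMargins P α X)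
    (hsrd : Summable (fun t : ℕ => 2 - pairCoeff P X ((t : ℤ) + 1))) {S : Finset ℤ}
    (hS : S.Nonempty) :
    Summable (fun t : ℕ => tailCoeff P X (S ∪ shift S ((t : ℤ) + 1))) := by
  refine Summable.of_nonneg_of_le (fun t => ?_) (fun t => ?_) (summable_lagBound hX hstat hsrd S)
  · refine ge_of_tendsto (tendsto_lagCov_div hα hX hmax hfre hS _) ?_
    filter_upwards [eventually_gt_atTop 0] with u hu
    exact div_nonneg (lagCov_nonneg hα hX hmax hfre hu S _) measureReal_nonneg
  · refine le_of_tendsto (tendsto_lagCov_div hα hX hmax hfre hS _) ?_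
    filter_upwards [eventually_level hα] with u hu
    exact lagCov_div_le hα hX hstat hmax hfre hu.1 hu.2 S _

/-- The variance of a count over a long window, relative to its mean, converges to `asympVar`.
This is dominated convergence for the series of lagged covariances. -/
lemma tendsto_variance_div (hα : 0 < α) (hX : ∀ t, Measurable (X t)) (hstat : IsStationary P X)
    (hmax : IsMaxStable P X) (hfre : HasFrechetMargins P α X)
    (hsrd : Summable (fun t : ℕ => 2 - pairCoeff P X ((t : ℤ) + 1))) {S : Finset ℤ}
    (hS : S.Nonempty) {u : ℕ → ℝ} (hu : Tendsto u atTop atTop) {l : ℕ → ℕ}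
    (hl : Tendsto l atTop atTop) (a : ℤ) :
    Tendsto (fun n => Var[fun ω => ∑ i ∈ Finset.range (l n),
        exceedInd X (u n) (shift S (a + i)) ω; P] / (l n * exceedProb P X (u n)))
      atTop (𝓝 (asympVar P X S)) := by
  set f : ℕ → ℕ → ℝ := fun n t => (if t < l n then 1 - ((t : ℝ) + 1) / l n else 0)
    * (lagCov P X S (u n) ((t : ℤ) + 1) / exceedProb P X (u n)) with hf
  have hlR : Tendsto (fun n => (l n : ℝ)) atTop atTop := tendsto_natCast_atTop_atTop.comp hl
  have hw : ∀ t : ℕ, Tendsto (fun n => if t < l n then 1 - ((t : ℝ) + 1) / l n else 0) atTop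
      (𝓝 1) := by
    intro t
    have h1 : Tendsto (fun n => 1 - ((t : ℝ) + 1) / l n) atTop (𝓝 (1 - 0)) :=
      tendsto_const_nhds.sub (hlR.const_div_atTop _)
    rw [sub_zero] at h1
    refine h1.congr' ?_
    filter_upwards [hl.eventually_gt_atTop t] with n hn
    rw [if_pos hn]
  have hsum : Tendsto (fun n => ∑' t, f n t) atTop
      (𝓝 (∑' t : ℕ, tailCoeff P X (S ∪ shift S ((t : ℤ) + 1)))) := by
    refine tendsto_tsum_of_dominated_convergence (summable_lagBound hX hstat hsrd S)
      (fun t => ?_) ?_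
    · have h := (hw t).mul ((tendsto_lagCov_div hα hX hmax hfre hS ((t : ℤ) + 1)).comp hu)
      rw [one_mul] at h
      exact h
    · filter_upwards [hu.eventually (eventually_level hα)] with n hn t
      have h1 := lagCov_div_le hα hX hstat hmax hfre hn.1 hn.2 S ((t : ℤ) + 1)
      have h2 : 0 ≤ lagCov P X S (u n) ((t : ℤ) + 1) / exceedProb P X (u n) :=
        div_nonneg (lagCov_nonneg hα hX hmax hfre hn.1 S _) measureReal_nonneg
      have h3 : |if t < l n then 1 - ((t : ℝ) + 1) / l n else 0| ≤ 1 := by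
        split_ifs with h
        · have hl0 : (0 : ℝ) < l n := by exact_mod_cast (Nat.zero_le t).trans_lt h
          have h4 : ((t : ℝ) + 1) / l n ≤ 1 := (div_le_one hl0).2 (by exact_mod_cast h)
          have h5 : 0 ≤ ((t : ℝ) + 1) / l n := by positivity
          rw [abs_le]
          constructor <;> linarith
        · simp
      rw [hf, norm_mul, Real.norm_eq_abs, Real.norm_of_nonneg h2]
      exact (mul_le_of_le_one_left h2 h3).trans h1
  have h0 := (tendsto_lagCov_div hα hX hmax hfre hS 0).comp hu
  rw [shift_zero, Finset.union_self] at h0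
  refine (h0.add (hsum.const_mul 2)).congr' ?_
  filter_upwards [hu.eventually (eventually_level hα), hl.eventually_gt_atTop 0] with n hn hln
  have hp := exceedProb_pos hX hfre hn.1
  have hl0 : (0 : ℝ) < l n := by exact_mod_cast hln
  rw [variance_sum_exceedInd hX hstat, tsum_eq_sum (s := Finset.range (l n))]
  · have e : ∀ t ∈ Finset.range (l n), f n t
        = ((l n : ℝ) - (t + 1)) * lagCov P X S (u n) (t + 1) / (l n * exceedProb P X (u n)) := by
      intro t ht
      rw [hf]
      simp only [if_pos (Finset.mem_range.1 ht)]
      field_simp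
    rw [Finset.sum_congr rfl e, ← Finset.sum_div]
    simp only [Function.comp]
    field_simp
  · intro t ht
    rw [hf]
    simp only [if_neg (fun h => ht (Finset.mem_range.2 h)), zero_mul]

lemma asympVar_nonneg (hα : 0 < α) (hX : ∀ t, Measurable (X t)) (hstat : IsStationary P X)
    (hmax : IsMaxStable P X) (hfre : HasFrechetMargins P α X)
    (hsrd : Summable (fun t : ℕ => 2 - pairCoeff P X ((t : ℤ) + 1))) {S : Finset ℤ}
    (hS : S.Nonempty) : 0 ≤ asympVar P X S :=
  ge_of_tendsto' (tendsto_variance_div hα hX hstat hmax hfre hsrd hS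
    (tendsto_natCast_atTop_atTop (R := ℝ)) tendsto_id 0) fun _ =>
    div_nonneg (variance_nonneg _ _) (mul_nonneg (Nat.cast_nonneg _) measureReal_nonneg)

end Variance

/-! ### Asymptotic normality of exceedance counts -/

section CLT

variable {P : Measure Ω} {X : ℤ → Ω → ℝ} {α : ℝ}

/-- The centred count of joint exceedances at times `1, …, k`, divided by `√N`. -/
noncomputable def normCount (P : Measure Ω) (X : ℤ → Ω → ℝ) (S : Finset ℤ) (u N : ℝ) (k : ℕ)
    (ω : Ω) : ℝ :=
  ∑ i ∈ Finset.range k, (exceedInd X u (shift S (1 + i)) ω - P.real (allExceed X u S)) / √N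

lemma measurable_normCount (hX : ∀ t, Measurable (X t)) (S : Finset ℤ) (u N : ℝ) (k : ℕ) :
    Measurable (normCount P X S u N k) := by
  refine Finset.measurable_fun_sum _ fun i _ => ?_
  exact ((measurable_exceedInd hX u _).sub_const _).div_const _

variable [IsProbabilityMeasure P]

lemma isAssociated_pattern (hα : 0 < α) (hX : ∀ t, Measurable (X t)) (hmax : IsMaxStable P X)
    (hfre : HasFrechetMargins P α X) (J : Finset ℤ) {u : ℝ} (hu : 0 < u) :
    IsAssociated P (fun ω => pattern J u (fun t => X t ω)) :=
  ⟨memLp_comp_pattern hX J u, fun _ _ => covariance_pattern_nonneg hα hX hmax hfre J hu⟩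

lemma abs_exceedInd_sub_le (S : Finset ℤ) (u N : ℝ) (t : ℤ) (ω : Ω) :
    |(exceedInd X u (shift S t) ω - P.real (allExceed X u S)) / √N| ≤ 1 / √N := by
  rw [abs_div, abs_of_nonneg (Real.sqrt_nonneg N)]
  refine div_le_div_of_nonneg_right ?_ (Real.sqrt_nonneg N)
  have h1 := exceedInd_nonneg (X := X) u (shift S t) ω
  have h2 := exceedInd_le_one (X := X) u (shift S t) ω
  have h3 : 0 ≤ P.real (allExceed X u S) := measureReal_nonneg
  have h4 : P.real (allExceed X u S) ≤ 1 := measureReal_le_one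
  rw [abs_le]
  constructor <;> linarith

lemma integral_centred_exceedInd (hX : ∀ t, Measurable (X t)) (hstat : IsStationary P X)
    (S : Finset ℤ) (u N : ℝ) (t : ℤ) :
    ∫ ω, (exceedInd X u (shift S t) ω - P.real (allExceed X u S)) / √N ∂P = 0 := by
  rw [integral_div, integral_sub ((memLp_exceedInd hX u _).integrable (by norm_num))
    (integrable_const _), integral_exceedInd hX, prob_allExceed_shift hX hstat]
  simp

lemma variance_centred_sum (hX : ∀ t, Measurable (X t)) (hstat : IsStationary P X) (u : ℝ) {N : ℝ}
    (hN : 0 ≤ N) (S : Finset ℤ) (a b : ℤ) (l : ℕ) :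
    Var[fun ω => ∑ i ∈ Finset.range l,
        (exceedInd X u (shift S (a + i)) ω - P.real (allExceed X u S)) / √N; P]
      = Var[fun ω => ∑ i ∈ Finset.range l, exceedInd X u (shift S (b + i)) ω; P] / N := by
  have e : (fun ω => ∑ i ∈ Finset.range l,
        (exceedInd X u (shift S (a + i)) ω - P.real (allExceed X u S)) / √N)
      = fun ω => (√N)⁻¹ * (∑ i ∈ Finset.range l, exceedInd X u (shift S (a + i)) ω
          - l * P.real (allExceed X u S)) := by
    ext ω
    rw [← Finset.sum_div, Finset.sum_sub_distrib, Finset.sum_const, Finset.card_range,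
      nsmul_eq_mul]
    ring
  rw [e, variance_const_mul, variance_sub_const, inv_pow, Real.sq_sqrt hN,
    variance_sum_exceedInd hX hstat, variance_sum_exceedInd hX hstat]
  · ring
  · exact (Finset.measurable_fun_sum _ fun i _ =>
      measurable_exceedInd hX u _).aestronglyMeasurable

lemma sum_range_mul_eq (f : ℕ → ℝ) (m l : ℕ) :
    ∑ j ∈ Finset.range m, ∑ i ∈ Finset.range l, f (j * l + i)
      = ∑ i ∈ Finset.range (m * l), f i := by
  induction m with
  | zero => simp
  | succ m ih => rw [Finset.sum_range_succ, ih, Nat.succ_mul, Finset.sum_range_add]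

/-- The estimate behind the central limit theorem, for a sum over `m` blocks of length `l`. -/
lemma norm_chf_normCount_sub_le (hα : 0 < α) (hX : ∀ t, Measurable (X t))
    (hstat : IsStationary P X) (hmax : IsMaxStable P X) (hfre : HasFrechetMargins P α X)
    {u : ℝ} (hu : 0 < u) {N : ℝ} (hN : 0 < N) (S : Finset ℤ) (l m : ℕ) {s : ℝ}
    (hsK : |s| * (l / √N) ≤ 1) :
    ‖chf P s (normCount P X S u N (m * l))
      - (Real.exp (-(s ^ 2 / 2 * (m * (Var[fun ω => ∑ i ∈ Finset.range l,
          exceedInd X u (shift S (1 + i)) ω; P] / N)))) : ℂ)‖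
      ≤ 2 * s ^ 2 * (Var[fun ω => ∑ i ∈ Finset.range (m * l),
            exceedInd X u (shift S (1 + i)) ω; P] / N
          - m * (Var[fun ω => ∑ i ∈ Finset.range l,
            exceedInd X u (shift S (1 + i)) ω; P] / N))
        + 2 * |s| ^ 3 * (l / √N) * (m * (Var[fun ω => ∑ i ∈ Finset.range l,
            exceedInd X u (shift S (1 + i)) ω; P] / N)) := by
  set q := P.real (allExceed X u S) with hq
  set J : Finset ℤ := (Finset.range (m * l)).biUnion fun i => shift S (1 + i) with hJ
  set Z : Ω → Finset ℤ := fun ω => pattern J u (fun t => X t ω) with hZ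
  set ψ : ℕ → Finset ℤ → ℝ := fun j A =>
    ∑ i ∈ Finset.range l, (hits (shift S (1 + (j * l : ℕ) + i)) A - q) / √N with hψ
  have hidx : ∀ j < m, ∀ i < l, j * l + i < m * l := fun j hj i hi => by
    calc j * l + i < j * l + l := by omega
      _ = (j + 1) * l := by ring
      _ ≤ m * l := Nat.mul_le_mul_right l hj
  have hval : ∀ j < m, ∀ ω, ψ j (Z ω) = ∑ i ∈ Finset.range l,
      (exceedInd X u (shift S (1 + (j * l : ℕ) + i)) ω - q) / √N := by
    intro j hj ω
    refine Finset.sum_congr rfl fun i hi => ?_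
    rw [exceedInd_eq_hits (J := J)]
    intro t ht
    refine Finset.mem_biUnion.2 ⟨j * l + i,
      Finset.mem_range.2 (hidx j hj i (Finset.mem_range.1 hi)), ?_⟩
    push_cast at ht ⊢
    rwa [← add_assoc]
  have hvar : ∀ j < m, Var[fun ω => ψ j (Z ω); P] = Var[fun ω => ∑ i ∈ Finset.range l,
      exceedInd X u (shift S (1 + i)) ω; P] / N := by
    intro j hj
    rw [funext (hval j hj), variance_centred_sum hX hstat u hN.le S _ 1]
  have hsum : (fun ω => ∑ j ∈ Finset.range m, ψ j (Z ω)) = normCount P X S u N (m * l) := by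
    ext ω
    rw [normCount, Finset.sum_congr rfl fun j hj => hval j (Finset.mem_range.1 hj) ω]
    rw [← sum_range_mul_eq]
    refine Finset.sum_congr rfl fun j _ => Finset.sum_congr rfl fun i _ => ?_
    push_cast
    rw [add_assoc]
  have hmain := (isAssociated_pattern hα hX hmax hfre J hu).norm_chf_sum_sub_exp_le (ψ := ψ)
    (K := l / √N) (s := s) (fun j => measurable_comp_pattern hX J u (ψ j)) ?_ hsK m ?_ ?_
  · have hsumvar : ∑ j ∈ Finset.range m, Var[fun ω => ψ j (Z ω); P]
        = m * (Var[fun ω => ∑ i ∈ Finset.range l,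
          exceedInd X u (shift S (1 + i)) ω; P] / N) := by
      rw [Finset.sum_congr rfl fun j hj => hvar j (Finset.mem_range.1 hj)]
      simp
    change ‖chf P s (fun ω => ∑ j ∈ Finset.range m, ψ j (Z ω))
      - (Real.exp (-(s ^ 2 / 2 * ∑ j ∈ Finset.range m, Var[fun ω => ψ j (Z ω); P])) : ℂ)‖
      ≤ 2 * s ^ 2 * (Var[fun ω => ∑ j ∈ Finset.range m, ψ j (Z ω); P]
          - ∑ j ∈ Finset.range m, Var[fun ω => ψ j (Z ω); P])
        + 2 * |s| ^ 3 * (l / √N) * ∑ j ∈ Finset.range m, Var[fun ω => ψ j (Z ω); P] at hmain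
    rw [hsum, hsumvar] at hmain
    rwa [← variance_centred_sum hX hstat u hN.le S 1 1 (m * l)]
  · intro j A B hAB
    refine Finset.sum_le_sum fun i _ => ?_
    exact div_le_div_of_nonneg_right (sub_le_sub_right (hits_mono _ hAB) _) (Real.sqrt_nonneg N)
  · intro j hj ω
    change |ψ j (Z ω)| ≤ _
    rw [hval j hj]
    refine (Finset.abs_sum_le_sum_abs _ _).trans ?_
    refine (Finset.sum_le_sum fun i _ => abs_exceedInd_sub_le S u N _ ω).trans ?_
    rw [Finset.sum_const, Finset.card_range, nsmul_eq_mul, mul_one_div]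
  · intro j hj
    change ∫ ω, ψ j (Z ω) ∂P = 0
    simp_rw [hval j hj]
    rw [integral_finsetSum]
    · exact Finset.sum_eq_zero fun i _ => integral_centred_exceedInd hX hstat S u N _
    · intro i _
      exact (((memLp_exceedInd hX u _).integrable (by norm_num)).sub
        (integrable_const _)).div_const _

/-- Central limit theorem for counts of joint exceedances, at the level of characteristic
functions. -/
lemma tendsto_chf_normCount (hα : 0 < α) (hX : ∀ t, Measurable (X t))
    (hstat : IsStationary P X) (hmax : IsMaxStable P X) (hfre : HasFrechetMargins P α X)
    (hsrd : Summable (fun t : ℕ => 2 - pairCoeff P X ((t : ℤ) + 1))) {S : Finset ℤ}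
    (hS : S.Nonempty) {u : ℕ → ℝ} (hu : Tendsto u atTop atTop)
    (hnp : Tendsto (fun n : ℕ => (n : ℝ) * exceedProb P X (u n)) atTop atTop) (s : ℝ) :
    Tendsto (fun n : ℕ => chf P s (normCount P X S (u n) (n * exceedProb P X (u n)) n)) atTop
      (𝓝 (Real.exp (-(s ^ 2 / 2 * asympVar P X S)) : ℂ)) := by
  set N : ℕ → ℝ := fun n => (n : ℝ) * exceedProb P X (u n) with hNdef
  have hNn : ∀ n, N n ≤ n := fun n => mul_le_of_le_one_right (Nat.cast_nonneg n) measureReal_le_one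
  -- the block length `l` satisfies `l ^ 4 ≤ N`, so that blocks are negligible relative to `√N`
  set l : ℕ → ℕ := fun n => ⌊√√(N n)⌋₊ with hl
  set m : ℕ → ℕ := fun n => n / l n with hm
  have hsqrt : Tendsto (fun n => √√(N n)) atTop atTop :=
    Real.tendsto_sqrt_atTop.comp (Real.tendsto_sqrt_atTop.comp hnp)
  have hlt : Tendsto l atTop atTop := tendsto_nat_floor_atTop.comp hsqrt
  have hll : ∀ n, (l n : ℝ) ≤ √√(N n) := fun n => Nat.floor_le (Real.sqrt_nonneg _)
  have hK : Tendsto (fun n => (l n : ℝ) / √(N n)) atTop (𝓝 0) := by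
    refine squeeze_zero' (Eventually.of_forall fun n => by positivity) ?_
      (tendsto_inv_atTop_zero.comp hsqrt)
    filter_upwards [hnp.eventually_gt_atTop 0] with n hn
    have h1 : 0 < √√(N n) := Real.sqrt_pos.2 (Real.sqrt_pos.2 hn)
    have h2 : √(N n) = √√(N n) * √√(N n) := (Real.mul_self_sqrt (Real.sqrt_nonneg _)).symm
    rw [div_le_iff₀ (Real.sqrt_pos.2 hn)]
    refine (hll n).trans (le_of_eq ?_)
    change _ = (√√(N n))⁻¹ * √(N n)
    rw [inv_mul_eq_div, eq_div_iff h1.ne']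
    exact h2.symm
  have hln : Tendsto (fun n => (l n : ℝ) / n) atTop (𝓝 0) := by
    refine squeeze_zero' (Eventually.of_forall fun n => by positivity) ?_ hK
    filter_upwards [hnp.eventually_ge_atTop 1, eventually_gt_atTop 0] with n hn hn0
    have h1 : √(N n) ≤ n := by
      refine (Real.sqrt_le_left (by linarith)).2 ?_ |>.trans (hNn n)
      have : (1 : ℝ) ≤ N n := hn
      nlinarith
    exact div_le_div_of_nonneg_left (Nat.cast_nonneg _)
      (Real.sqrt_pos.2 (lt_of_lt_of_le one_pos hn)) h1
  have hml : ∀ n, m n * l n ≤ n := fun n => Nat.div_mul_le_self n (l n)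
  have hml' : ∀ᶠ n in atTop, n < m n * l n + l n := by
    filter_upwards [hlt.eventually_gt_atTop 0] with n hn
    have := Nat.lt_div_mul_add (a := n) hn
    exact this
  have hfrac : Tendsto (fun n => ((m n * l n : ℕ) : ℝ) / n) atTop (𝓝 1) := by
    have h1 : Tendsto (fun n => 1 - (l n : ℝ) / n) atTop (𝓝 1) := by
      simpa using tendsto_const_nhds.sub hln
    refine tendsto_of_tendsto_of_tendsto_of_le_of_le' h1 tendsto_const_nhds ?_ ?_
    · filter_upwards [hml', eventually_gt_atTop 0] with n hn hn0
      have hn0' : (0 : ℝ) < n := by exact_mod_cast hn0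
      have hn' : (n : ℝ) < ((m n * l n : ℕ) : ℝ) + l n := by exact_mod_cast hn
      rw [le_div_iff₀ hn0', sub_mul, div_mul_cancel₀ _ hn0'.ne']
      linarith
    · exact Eventually.of_forall fun n => div_le_one_of_le₀ (by exact_mod_cast hml n)
        (Nat.cast_nonneg n)
  have hmlt : Tendsto (fun n => m n * l n) atTop atTop := by
    have h1 : Tendsto (fun n : ℕ => ((m n * l n : ℕ) : ℝ) / n * n) atTop atTop :=
      hfrac.pos_mul_atTop one_pos tendsto_natCast_atTop_atTop
    rw [← tendsto_natCast_atTop_iff (R := ℝ)]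
    refine h1.congr' ?_
    filter_upwards [eventually_gt_atTop 0] with n hn0
    have hn0' : (n : ℝ) ≠ 0 := by exact_mod_cast hn0.ne'
    rw [div_mul_cancel₀ _ hn0']
  set V : ℕ → ℕ → ℝ := fun n k => Var[fun ω => ∑ i ∈ Finset.range k,
    exceedInd X (u n) (shift S (1 + i)) ω; P] with hV
  set σ := asympVar P X S with hσ
  have hpos : ∀ᶠ n in atTop, 0 < u n := hu.eventually_gt_atTop 0
  have hV1 : Tendsto (fun n => V n (m n * l n) / N n) atTop (𝓝 σ) := by
    have h1 := (tendsto_variance_div hα hX hstat hmax hfre hsrd hS hu hmlt 1).mul hfrac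
    rw [mul_one] at h1
    refine h1.congr' ?_
    filter_upwards [hpos, eventually_gt_atTop 0, hmlt.eventually_gt_atTop 0] with n hun hn0 hmn
    have hp := exceedProb_pos hX hfre hun
    have hn0' : (n : ℝ) ≠ 0 := by exact_mod_cast hn0.ne'
    have hmn' : ((m n * l n : ℕ) : ℝ) ≠ 0 := by exact_mod_cast hmn.ne'
    simp only [hV, hNdef]
    field_simp
  have hV2 : Tendsto (fun n => m n * (V n (l n) / N n)) atTop (𝓝 σ) := by
    have h1 := (tendsto_variance_div hα hX hstat hmax hfre hsrd hS hu hlt 1).mul hfrac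
    rw [mul_one] at h1
    refine h1.congr' ?_
    filter_upwards [hpos, eventually_gt_atTop 0, hlt.eventually_gt_atTop 0] with n hun hn0 hln
    have hp := exceedProb_pos hX hfre hun
    have hn0' : (n : ℝ) ≠ 0 := by exact_mod_cast hn0.ne'
    have hln' : (l n : ℝ) ≠ 0 := by exact_mod_cast hln.ne'
    simp only [hV, hNdef]
    push_cast
    field_simp
  -- the blocks
  have hblocks : Tendsto (fun n => chf P s (normCount P X S (u n) (N n) (m n * l n))
      - (Real.exp (-(s ^ 2 / 2 * (m n * (V n (l n) / N n)))) : ℂ)) atTop (𝓝 0) := by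
    have hlim : Tendsto (fun n => 2 * s ^ 2 * (V n (m n * l n) / N n - m n * (V n (l n) / N n))
        + 2 * |s| ^ 3 * (l n / √(N n)) * (m n * (V n (l n) / N n))) atTop (𝓝 0) := by
      have := ((hV1.sub hV2).const_mul (2 * s ^ 2)).add
        ((hK.const_mul (2 * |s| ^ 3)).mul hV2)
      simpa using this
    refine squeeze_zero_norm' ?_ hlim
    have hsmall : Tendsto (fun n => |s| * (l n / √(N n))) atTop (𝓝 0) := by
      simpa using hK.const_mul |s|
    filter_upwards [hpos, hnp.eventually_gt_atTop 0,
      hsmall.eventually_le_const one_pos] with n hun hn hs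
    exact norm_chf_normCount_sub_le hα hX hstat hmax hfre hun hn S (l n) (m n) hs
  -- the incomplete block at the end
  have hrest : Tendsto (fun n => chf P s (normCount P X S (u n) (N n) n)
      - chf P s (normCount P X S (u n) (N n) (m n * l n))) atTop (𝓝 0) := by
    have hlim : Tendsto (fun n => |s| * (l n / √(N n))) atTop (𝓝 0) := by
      simpa using hK.const_mul |s|
    refine squeeze_zero_norm' ?_ hlim
    filter_upwards [hml'] with n hn
    refine norm_chf_sub_chf_le (measurable_normCount hX S _ _ _) (measurable_normCount hX S _ _ _)
      fun ω => ?_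
    unfold normCount
    rw [← Finset.sum_range_add_sum_Ico _ (hml n), add_sub_cancel_left]
    refine (Finset.abs_sum_le_sum_abs _ _).trans ?_
    refine (Finset.sum_le_sum fun i _ => abs_exceedInd_sub_le S (u n) (N n) _ ω).trans ?_
    rw [Finset.sum_const, Nat.card_Ico, nsmul_eq_mul, mul_one_div]
    refine div_le_div_of_nonneg_right ?_ (Real.sqrt_nonneg _)
    exact_mod_cast (by omega : n - m n * l n ≤ l n)
  have hgauss : Tendsto (fun n => (Real.exp (-(s ^ 2 / 2 * (m n * (V n (l n) / N n)))) : ℂ)) atTop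
      (𝓝 (Real.exp (-(s ^ 2 / 2 * σ)) : ℂ)) :=
    (Complex.continuous_ofReal.tendsto _).comp
      ((Real.continuous_exp.tendsto _).comp (hV2.const_mul (s ^ 2 / 2)).neg)
  have := (hrest.add hblocks).add hgauss
  rw [zero_add, zero_add] at this
  refine this.congr fun n => ?_
  ring

end CLT

/-! ### Limit theorems for relative frequencies -/

section Frequencies

variable {P : Measure Ω} {X : ℤ → Ω → ℝ} {α : ℝ}

lemma chf_congr {U V : Ω → ℝ} (h : U =ᵐ[P] V) (s : ℝ) : chf P s U = chf P s V := by
  refine integral_congr_ae ?_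
  filter_upwards [h] with ω hω
  rw [hω]

variable [IsProbabilityMeasure P]

lemma convergesToNormal_of_chf {Z : ℕ → Ω → ℝ} (hZ : ∀ n, Measurable (Z n)) {v : ℝ} (hv : 0 ≤ v)
    (h : ∀ s : ℝ, Tendsto (fun n => chf P s (Z n)) atTop
      (𝓝 (Real.exp (-(s ^ 2 / 2 * v)) : ℂ))) : ConvergesToNormal P Z v := by
  refine ⟨hv, fun n => (hZ n).aemeasurable, aemeasurable_id, ?_⟩
  refine ProbabilityMeasure.tendsto_iff_tendsto_charFun.2 fun s => ?_
  have e1 : ∀ n, charFun (P.map (Z n)) s = chf P s (Z n) := by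
    intro n
    rw [charFun_apply_real, integral_map (hZ n).aemeasurable (by fun_prop), chf]
    simp
  have e2 : charFun ((gaussianReal 0 v.toNNReal).map id) s
      = (Real.exp (-(s ^ 2 / 2 * v)) : ℂ) := by
    rw [Measure.map_id, charFun_gaussianReal, Complex.ofReal_exp]
    congr 1
    rw [Real.coe_toNNReal v hv]
    push_cast
    ring
  change Tendsto (fun n => charFun (P.map (Z n)) s) atTop
    (𝓝 (charFun ((gaussianReal 0 v.toNNReal).map id) s))
  simp_rw [e1, e2]
  exact h s

/-- The relative frequency of joint exceedances at the translates of `S` by `1, …, n`. -/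
noncomputable def exceedFreq (X : ℤ → Ω → ℝ) (S : Finset ℤ) (u : ℝ) (n : ℕ) (ω : Ω) : ℝ :=
  (1 / (n : ℝ)) * ∑ i ∈ Finset.range n, exceedInd X u (shift S (1 + i)) ω

lemma tendsto_variance_exceedFreq (hα : 0 < α) (hX : ∀ t, Measurable (X t))
    (hstat : IsStationary P X) (hmax : IsMaxStable P X) (hfre : HasFrechetMargins P α X)
    (hsrd : Summable (fun t : ℕ => 2 - pairCoeff P X ((t : ℤ) + 1))) {S : Finset ℤ}
    (hS : S.Nonempty) {u : ℕ → ℝ} (hu : Tendsto u atTop atTop) {R : ℕ → Ω → ℝ}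
    (hR : ∀ᶠ n in atTop, R n =ᵐ[P] exceedFreq X S (u n) n) :
    Tendsto (fun n : ℕ => Var[fun ω => √((n : ℝ) * exceedProb P X (u n)) *
        (R n ω / exceedProb P X (u n)); P]) atTop (𝓝 (asympVar P X S)) := by
  refine (tendsto_variance_div hα hX hstat hmax hfre hsrd hS hu tendsto_id 1).congr' ?_
  filter_upwards [hR, hu.eventually_gt_atTop 0, eventually_gt_atTop 0] with n hn hun hn0
  have hp := exceedProb_pos hX hfre hun
  have hn0' : (0 : ℝ) < n := by exact_mod_cast hn0
  set p := exceedProb P X (u n)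
  have e : (fun ω => √((n : ℝ) * p) * (R n ω / p)) =ᵐ[P] fun ω => (√((n : ℝ) * p) / (n * p))
      * ∑ i ∈ Finset.range n, exceedInd X (u n) (shift S (1 + i)) ω := by
    filter_upwards [hn] with ω hω
    rw [hω, exceedFreq]
    field_simp
  rw [variance_congr e, variance_const_mul, div_pow, Real.sq_sqrt (by positivity)]
  simp only [id]
  field_simp

/-- Asymptotic normality of the relative frequency with a centring that deviates from the mean by
an asymptotically negligible amount. -/
lemma convergesToNormal_exceedFreq (hα : 0 < α) (hX : ∀ t, Measurable (X t))
    (hstat : IsStationary P X) (hmax : IsMaxStable P X) (hfre : HasFrechetMargins P α X)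
    (hsrd : Summable (fun t : ℕ => 2 - pairCoeff P X ((t : ℤ) + 1))) {S : Finset ℤ}
    (hS : S.Nonempty) {u : ℕ → ℝ} (hu : Tendsto u atTop atTop)
    (hnp : Tendsto (fun n : ℕ => (n : ℝ) * exceedProb P X (u n)) atTop atTop) {R : ℕ → Ω → ℝ}
    (hRm : ∀ n, Measurable (R n))
    (hR : ∀ᶠ n in atTop, R n =ᵐ[P] exceedFreq X S (u n) n) {c : ℕ → ℝ}
    (hc : Tendsto (fun n : ℕ => √((n : ℝ) * exceedProb P X (u n)) *
      (P.real (allExceed X (u n) S) / exceedProb P X (u n) - c n)) atTop (𝓝 0)) :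
    ConvergesToNormal P (fun (n : ℕ) ω => √((n : ℝ) * exceedProb P X (u n)) *
        (R n ω / exceedProb P X (u n) - c n)) (asympVar P X S) := by
  refine convergesToNormal_of_chf (fun n => (((hRm n).div_const _).sub_const _).const_mul _)
    (asympVar_nonneg hα hX hstat hmax hfre hsrd hS) fun s => ?_
  set δ : ℕ → ℝ := fun n => √((n : ℝ) * exceedProb P X (u n)) *
    (P.real (allExceed X (u n) S) / exceedProb P X (u n) - c n) with hδ
  have h1 := tendsto_chf_normCount hα hX hstat hmax hfre hsrd hS hu hnp s
  have h2 : Tendsto (fun n : ℕ => chf P s (fun ω => √((n : ℝ) * exceedProb P X (u n)) *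
      (R n ω / exceedProb P X (u n) - c n))
      - chf P s (normCount P X S (u n) (n * exceedProb P X (u n)) n)) atTop (𝓝 0) := by
    have hlim : Tendsto (fun n => |s| * |δ n|) atTop (𝓝 0) := by
      simpa using hc.abs.const_mul |s|
    refine squeeze_zero_norm' ?_ hlim
    filter_upwards [hR, hu.eventually_gt_atTop 0, eventually_gt_atTop 0] with n hn hun hn0
    have hp := exceedProb_pos hX hfre hun
    have hn0' : (0 : ℝ) < n := by exact_mod_cast hn0
    have e : (fun ω => √((n : ℝ) * exceedProb P X (u n)) *
        (R n ω / exceedProb P X (u n) - c n)) =ᵐ[P]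
        fun ω => normCount P X S (u n) (n * exceedProb P X (u n)) n ω + δ n := by
      filter_upwards [hn] with ω hω
      rw [hω, exceedFreq, normCount, ← Finset.sum_div, Finset.sum_sub_distrib,
        Finset.sum_const, Finset.card_range, nsmul_eq_mul]
      simp only [hδ]
      set p := exceedProb P X (u n)
      have hsq : 0 < √((n : ℝ) * p) := Real.sqrt_pos.2 (by positivity)
      have hss : √((n : ℝ) * p) ^ 2 = n * p := Real.sq_sqrt (by positivity)
      field_simp
      rw [hss]
      ring
    rw [chf_congr e]
    have hm := measurable_normCount (P := P) hX S (u n) (n * exceedProb P X (u n)) n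
    exact norm_chf_sub_chf_le (hm.add_const _) hm fun ω => by simp
  simpa using h2.add h1

end Frequencies

/-! ### Windows and their exceedance events -/

section Windows

variable {P : Measure Ω} {X : ℤ → Ω → ℝ} {α : ℝ}

/-- A finite set of natural numbers as a set of times in `ℤ`. -/
def intTimes (T : Finset ℕ) : Finset ℤ := T.image (fun s : ℕ => (s : ℤ))

lemma intTimes_nonempty {T : Finset ℕ} (hT : 0 ∈ T) : (intTimes T).Nonempty :=
  ⟨_, Finset.mem_image_of_mem _ hT⟩

lemma mem_exceedEvent {Ω : Type*} {X : ℤ → Ω → ℝ} {T S : Finset ℕ} {u : ℝ} (hu : 0 < u) {t : ℤ}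
    {ω : Ω} : ω ∈ exceedEvent X T S u t
      ↔ (∀ s ∈ T, 0 < X (t + s) ω) ∧ ∀ s ∈ T, s ∈ S → u < X (t + s) ω := by
  simp only [exceedEvent, exceedSet, window, Set.mem_ofPred_eq, Pi.smul_apply, smul_eq_mul,
    Subtype.forall]
  refine and_congr (forall₂_congr fun s _ => ?_) (forall₃_congr fun s _ _ => ?_)
  · rw [mul_pos_iff_of_pos_left (inv_pos.2 hu)]
  · rw [lt_inv_mul_iff₀ hu, mul_one]

lemma exceedEvent_self {Ω : Type*} {X : ℤ → Ω → ℝ} (T : Finset ℕ) {u : ℝ} (hu : 0 < u) (t : ℤ) :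
    exceedEvent X T T u t = allExceed X u (shift (intTimes T) t) := by
  ext ω
  rw [mem_exceedEvent hu]
  simp only [allExceed, Set.mem_ofPred_eq, forall_mem_shift, intTimes, Finset.forall_mem_image]
  simp only [add_comm t]
  exact ⟨fun h s hs => h.2 s hs hs, fun h => ⟨fun s hs => hu.trans (h hs), fun s hs _ => h hs⟩⟩

lemma measurableSet_exceedEvent (hX : ∀ t, Measurable (X t)) (T S : Finset ℕ) (u : ℝ) (t : ℤ) :
    MeasurableSet (exceedEvent X T S u t) := by
  have h1 : MeasurableSet (exceedSet T S) := by
    have : exceedSet T S = (⋂ s : T, {x | 0 < x s}) ∩ ⋂ s : T, {x | (s : ℕ) ∈ S → 1 < x s} := by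
      ext x
      simp [exceedSet]
    rw [this]
    refine (MeasurableSet.iInter fun s => measurableSet_lt measurable_const (by fun_prop)).inter
      (MeasurableSet.iInter fun s => ?_)
    by_cases hs : (s : ℕ) ∈ S
    · simpa [hs] using measurableSet_lt measurable_const (measurable_pi_apply s)
    · simp [hs]
  have h2 : Measurable (fun ω => u⁻¹ • window X T t ω) :=
    (measurable_pi_lambda _ fun s => hX _).const_smul u⁻¹
  exact h2 h1

lemma measurable_relFreq (hX : ∀ t, Measurable (X t)) (T S : Finset ℕ) (u : ℝ) (n : ℕ) :
    Measurable (relFreq X T S u n) := by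
  unfold relFreq
  refine (Finset.measurable_fun_sum _ fun t _ => ?_).const_mul _
  exact measurable_const.indicator (measurableSet_exceedEvent hX T S u t)

lemma relFreq_eq_exceedFreq {Ω : Type*} {X : ℤ → Ω → ℝ} {T S : Finset ℕ} {S' : Finset ℤ} {u : ℝ}
    (n : ℕ) {ω : Ω} (h : ∀ t, ω ∈ exceedEvent X T S u t ↔ ω ∈ allExceed X u (shift S' t)) :
    relFreq X T S u n ω = exceedFreq X S' u n ω := by
  have e : Finset.Icc 1 n = Finset.Ico 1 (1 + n) := by ext; simp; omega
  rw [relFreq, exceedFreq, e, Finset.sum_Ico_eq_sum_range, Nat.add_sub_cancel_left]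
  congr 1
  refine Finset.sum_congr rfl fun i _ => ?_
  have hi := h (1 + i)
  push_cast
  by_cases hω : ω ∈ exceedEvent X T S u (1 + i)
  · simp [exceedInd, hω, hi.1 hω]
  · simp [exceedInd, hω, mt hi.2 hω]

lemma chiRatio_eq (T : Finset ℕ) (u : ℝ) :
    chiRatio P X T u = P.real (allExceed X u (intTimes T)) / exceedProb P X u := by
  rw [chiRatio]
  congr 2
  ext ω
  simp [allExceed, intTimes]

lemma kappaRatio_eq (T : Finset ℕ) (t : ℕ) {u : ℝ} (hu : 0 < u) :
    kappaRatio P X T t u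
      = P.real (allExceed X u (intTimes T ∪ shift (intTimes T) t)) / exceedProb P X u := by
  rw [kappaRatio, exceedEvent_self T hu, exceedEvent_self T hu, shift_zero]
  congr 2
  ext ω
  simp only [allExceed, Finset.mem_union, Set.mem_ofPred_eq, Set.mem_inter_iff]
  exact ⟨fun h j hj => hj.elim (h.1 j) (h.2 j),
    fun h => ⟨fun j hj => h j (Or.inl hj), fun j hj => h j (Or.inr hj)⟩⟩

lemma extremalCoeff_singleton (hfre : HasFrechetMargins P α X) (t : ℤ) :
    extremalCoeff P X {t} = 1 := by
  have := hfre t 1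
  simp only [zero_lt_one, if_true, Real.one_rpow] at this
  simp [extremalCoeff, this]

lemma tailCoeff_singleton (hfre : HasFrechetMargins P α X) (t : ℤ) : tailCoeff P X {t} = 1 := by
  rw [tailCoeff, Finset.sum_filter, ← insert_empty_eq, Finset.sum_powerset_insert (by simp)]
  simp [extremalCoeff_singleton hfre]

lemma tailCoeff_pair (hfre : HasFrechetMargins P α X) {h : ℤ} (hh : h ≠ 0) :
    tailCoeff P X {0, h} = 2 - pairCoeff P X h := by
  rw [tailCoeff, Finset.sum_filter, Finset.sum_powerset_insert (by simpa using hh.symm),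
    ← insert_empty_eq, Finset.sum_powerset_insert (by simp), Finset.sum_powerset_insert (by simp)]
  have hc : ({0, h} : Finset ℤ).card = 2 := Finset.card_pair hh.symm
  simp [extremalCoeff_singleton hfre, pairCoeff, hc]
  ring

lemma sigmaSqZero_eq (hfre : HasFrechetMargins P α X) :
    sigmaSqZero P X = asympVar P X {0} := by
  rw [sigmaSqZero, asympVar, tailCoeff_singleton hfre]
  congr 3
  ext t
  rw [← tailCoeff_pair hfre (h := (t : ℤ) + 1) (by positivity)]
  congr 1
  simp [shift]

variable [IsProbabilityMeasure P]

lemma ae_pos (hfre : HasFrechetMargins P α X) :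
    ∀ᵐ ω ∂P, ∀ t, 0 < X t ω := by
  refine ae_all_iff.2 fun t => ?_
  have h := hfre t 0
  rw [if_neg (lt_irrefl _), measureReal_eq_zero_iff] at h
  rw [ae_iff]
  simpa using h

/-- The Fréchet margins make the positivity of the window in the definition of `C_0` automatic. -/
lemma exceedEvent_zero_ae (hfre : HasFrechetMargins P α X)
    {T : Finset ℕ} (hT : 0 ∈ T) {u : ℝ} (hu : 0 < u) :
    ∀ᵐ ω ∂P, ∀ t, ω ∈ exceedEvent X T {0} u t ↔ ω ∈ allExceed X u (shift {0} t) := by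
  filter_upwards [ae_pos hfre] with ω hω t
  rw [mem_exceedEvent hu]
  simp only [allExceed, Set.mem_ofPred_eq, forall_mem_shift, Finset.mem_singleton]
  constructor
  · rintro ⟨_, h⟩ j rfl
    simpa using h 0 hT rfl
  · intro h
    refine ⟨fun s _ => hω _, ?_⟩
    rintro s _ rfl
    simpa using h 0 rfl

lemma tendsto_chiRatio (hα : 0 < α) (hX : ∀ t, Measurable (X t)) (hmax : IsMaxStable P X)
    (hfre : HasFrechetMargins P α X) {T : Finset ℕ} (hT : 0 ∈ T) :
    Tendsto (chiRatio P X T) atTop (𝓝 (tailCoeff P X (intTimes T))) :=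
  (tendsto_prob_allExceed_div hα hX hmax hfre (intTimes_nonempty hT)).congr
    fun u => (chiRatio_eq T u).symm

lemma tendsto_kappaRatio (hα : 0 < α) (hX : ∀ t, Measurable (X t)) (hmax : IsMaxStable P X)
    (hfre : HasFrechetMargins P α X) {T : Finset ℕ} (hT : 0 ∈ T) (t : ℕ) :
    Tendsto (kappaRatio P X T t) atTop
      (𝓝 (tailCoeff P X (intTimes T ∪ shift (intTimes T) t))) := by
  refine (tendsto_prob_allExceed_div hα hX hmax hfre
    ((intTimes_nonempty hT).mono Finset.subset_union_left)).congr' ?_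
  filter_upwards [eventually_gt_atTop 0] with u hu using (kappaRatio_eq T t hu).symm

lemma chi_eq (hα : 0 < α) (hX : ∀ t, Measurable (X t)) (hmax : IsMaxStable P X)
    (hfre : HasFrechetMargins P α X) {T : Finset ℕ} (hT : 0 ∈ T) :
    chi P X T = tailCoeff P X (intTimes T) := (tendsto_chiRatio hα hX hmax hfre hT).limUnder_eq

lemma kappa_eq (hα : 0 < α) (hX : ∀ t, Measurable (X t)) (hmax : IsMaxStable P X)
    (hfre : HasFrechetMargins P α X) {T : Finset ℕ} (hT : 0 ∈ T) (t : ℕ) :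
    kappa P X T t = tailCoeff P X (intTimes T ∪ shift (intTimes T) t) :=
  (tendsto_kappaRatio hα hX hmax hfre hT t).limUnder_eq

lemma sigmaSq_eq (hα : 0 < α) (hX : ∀ t, Measurable (X t)) (hmax : IsMaxStable P X)
    (hfre : HasFrechetMargins P α X) {T : Finset ℕ} (hT : 0 ∈ T) :
    sigmaSq P X T = asympVar P X (intTimes T) := by
  simp only [sigmaSq, asympVar, chi_eq hα hX hmax hfre hT, kappa_eq hα hX hmax hfre hT]
  push_cast
  rfl

end Windows

end MaxStableSeries

theorem mainTheorem2 {Ω : Type*} [MeasurableSpace Ω] (P : Measure Ω) [IsProbabilityMeasure P]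
    (X : ℤ → Ω → ℝ) (hX : ∀ t, Measurable (X t))
    (α : ℝ) (hα : 0 < α)
    (hstat : MaxStableSeries.IsStationary P X)
    (hmax : MaxStableSeries.IsMaxStable P X)
    (hfre : MaxStableSeries.HasFrechetMargins P α X)
    (hsrd : Summable (fun t : ℕ => 2 - MaxStableSeries.pairCoeff P X ((t : ℤ) + 1)))
    (T : Finset ℕ) (hT : 0 ∈ T)
    (u : ℕ → ℝ) (hu : Tendsto u atTop atTop)
    (hnp : Tendsto (fun n : ℕ => (n : ℝ) * MaxStableSeries.exceedProb P X (u n)) atTop atTop) :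
    -- the limits `χ_T` and `κ_{t,T}` exist and `∑ κ_{t,T}` converges
    Tendsto (MaxStableSeries.chiRatio P X T) atTop (𝓝 (MaxStableSeries.chi P X T)) ∧
    (∀ t : ℕ, Tendsto (MaxStableSeries.kappaRatio P X T t) atTop
      (𝓝 (MaxStableSeries.kappa P X T t))) ∧
    Summable (fun t : ℕ => MaxStableSeries.kappa P X T (t + 1)) ∧
    -- `σ_0²` and `σ_T²` are the limiting variances
    Tendsto (fun n : ℕ => variance (fun ω =>
        √((n : ℝ) * MaxStableSeries.exceedProb P X (u n)) *
          (MaxStableSeries.denomEst X T (u n) n ω / MaxStableSeries.exceedProb P X (u n))) P)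
      atTop (𝓝 (MaxStableSeries.sigmaSqZero P X)) ∧
    Tendsto (fun n : ℕ => variance (fun ω =>
        √((n : ℝ) * MaxStableSeries.exceedProb P X (u n)) *
          (MaxStableSeries.numEst X T (u n) n ω / MaxStableSeries.exceedProb P X (u n))) P)
      atTop (𝓝 (MaxStableSeries.sigmaSq P X T)) ∧
    -- asymptotic normality of the denominator
    MaxStableSeries.ConvergesToNormal P (fun (n : ℕ) ω =>
        √((n : ℝ) * MaxStableSeries.exceedProb P X (u n)) *
          (MaxStableSeries.denomEst X T (u n) n ω / MaxStableSeries.exceedProb P X (u n) - 1))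
      (MaxStableSeries.sigmaSqZero P X) ∧
    -- asymptotic normality of the numerator, centred at its expectation
    MaxStableSeries.ConvergesToNormal P (fun (n : ℕ) ω =>
        √((n : ℝ) * MaxStableSeries.exceedProb P X (u n)) *
          (MaxStableSeries.numEst X T (u n) n ω / MaxStableSeries.exceedProb P X (u n)
            - P.real (MaxStableSeries.exceedEvent X T T (u n) 0) /
                MaxStableSeries.exceedProb P X (u n)))
      (MaxStableSeries.sigmaSq P X T) ∧
    -- asymptotic normality of the numerator, centred at `χ_T`, when the bias is negligible
    (Tendsto (fun n : ℕ => (n : ℝ) * MaxStableSeries.exceedProb P X (u n) ^ 3) atTop (𝓝 0) →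
      MaxStableSeries.ConvergesToNormal P (fun (n : ℕ) ω =>
          √((n : ℝ) * MaxStableSeries.exceedProb P X (u n)) *
            (MaxStableSeries.numEst X T (u n) n ω / MaxStableSeries.exceedProb P X (u n)
              - MaxStableSeries.chi P X T))
        (MaxStableSeries.sigmaSq P X T)) := by
  have hS := MaxStableSeries.intTimes_nonempty hT
  have hupos : ∀ᶠ n in atTop, 0 < u n := hu.eventually_gt_atTop 0
  have hnum : ∀ᶠ n in atTop, MaxStableSeries.numEst X T (u n) n
      =ᵐ[P] MaxStableSeries.exceedFreq X (MaxStableSeries.intTimes T) (u n) n := by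
    filter_upwards [hupos] with n hn
    refine ae_of_all _ fun ω => MaxStableSeries.relFreq_eq_exceedFreq n fun t => ?_
    rw [MaxStableSeries.exceedEvent_self T hn]
  have hden : ∀ᶠ n in atTop, MaxStableSeries.denomEst X T (u n) n
      =ᵐ[P] MaxStableSeries.exceedFreq X {0} (u n) n := by
    filter_upwards [hupos] with n hn
    filter_upwards [MaxStableSeries.exceedEvent_zero_ae hfre hT hn] with ω hω
    exact MaxStableSeries.relFreq_eq_exceedFreq n hω
  have hχ := MaxStableSeries.chi_eq hα hX hmax hfre hT
  have hκ := MaxStableSeries.kappa_eq hα hX hmax hfre hT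
  rw [MaxStableSeries.sigmaSqZero_eq hfre, MaxStableSeries.sigmaSq_eq hα hX hmax hfre hT]
  refine ⟨hχ ▸ MaxStableSeries.tendsto_chiRatio hα hX hmax hfre hT,
    fun t => hκ t ▸ MaxStableSeries.tendsto_kappaRatio hα hX hmax hfre hT t, ?_,
    MaxStableSeries.tendsto_variance_exceedFreq hα hX hstat hmax hfre hsrd
      (Finset.singleton_nonempty 0) hu hden,
    MaxStableSeries.tendsto_variance_exceedFreq hα hX hstat hmax hfre hsrd hS hu hnum,
    MaxStableSeries.convergesToNormal_exceedFreq hα hX hstat hmax hfre hsrd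
      (Finset.singleton_nonempty 0) hu hnp
      (fun n => MaxStableSeries.measurable_relFreq hX T {0} (u n) n) hden ?_,
    MaxStableSeries.convergesToNormal_exceedFreq hα hX hstat hmax hfre hsrd hS hu hnp
      (fun n => MaxStableSeries.measurable_relFreq hX T T (u n) n) hnum ?_, fun hbias =>
    MaxStableSeries.convergesToNormal_exceedFreq hα hX hstat hmax hfre hsrd hS hu hnp
      (fun n => MaxStableSeries.measurable_relFreq hX T T (u n) n) hnum ?_⟩
  · simp only [hκ]
    exact_mod_cast MaxStableSeries.summable_tailCoeff hα hX hstat hmax hfre hsrd hS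
  · refine tendsto_const_nhds.congr' ?_
    filter_upwards [hupos] with n hn
    have hp := MaxStableSeries.exceedProb_pos hX hfre hn
    have e : P.real (MaxStableSeries.allExceed X (u n) {0})
        = MaxStableSeries.exceedProb P X (u n) := by
      simp [MaxStableSeries.allExceed, MaxStableSeries.exceedProb]
    rw [e, div_self hp.ne', sub_self, mul_zero]
  · refine tendsto_const_nhds.congr' ?_
    filter_upwards [hupos] with n hn
    rw [MaxStableSeries.exceedEvent_self T hn, MaxStableSeries.shift_zero, sub_self, mul_zero]
  · -- the bias is `O(p)`, and `√(n p) p = √(n p ^ 3)`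
    obtain ⟨C, hC⟩ := MaxStableSeries.abs_prob_allExceed_div_sub_le hα hX hmax hfre hS
    have hlim : Tendsto (fun n : ℕ => C * √((n : ℝ) * MaxStableSeries.exceedProb P X (u n) ^ 3))
        atTop (𝓝 0) := by
      simpa using ((Real.continuous_sqrt.tendsto 0).comp hbias).const_mul C
    refine squeeze_zero_norm' ?_ hlim
    filter_upwards [hu.eventually hC] with n hn
    have hp : 0 ≤ MaxStableSeries.exceedProb P X (u n) := measureReal_nonneg
    rw [hχ, norm_mul, Real.norm_of_nonneg (Real.sqrt_nonneg _), Real.norm_eq_abs]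
    refine (mul_le_mul_of_nonneg_left hn (Real.sqrt_nonneg _)).trans (le_of_eq ?_)
    rw [show (n : ℝ) * MaxStableSeries.exceedProb P X (u n) ^ 3
      = n * MaxStableSeries.exceedProb P X (u n) * MaxStableSeries.exceedProb P X (u n) ^ 2 by ring,
      Real.sqrt_mul (mul_nonneg (Nat.cast_nonneg n) hp), Real.sqrt_sq hp]
    ring
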